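/- Let $G$ be a second-countable locally compact Hausdorff groupoid with a (left) Haar system $\lambda=\{\lambda^u\}_{u\in G^{(0)}}$, range map $r$, source map $s$ and set of composable pairs $G^{(2)}$. Let $\omega:G^{(2)}\to\mathbb T$ be a continuous normalized 2-cocycle, that is, $$\omega(\gamma,\eta)\,\omega(\gamma\eta,\xi)=\omega(\eta,\xi)\,\omega(\gamma,\eta\xi)\quad\text{and}\quad \omega(r(\gamma),\gamma)=1=\omega(\gamma,s(\gamma)).$$ Let $G^\omega=\mathbb T\times_\omega G$ be the associated extension: the space $\mathbb T\times G$ with the product topology, with multiplication $(t,\eta)(t',\gamma)=(tt'\omega(\eta,\gamma),\eta\gamma)$ for $s(\eta)=r(\gamma)$, inverse $(t,\gamma)^{-1}=(t^{-1}\omega(\gamma,\gamma^{-1})^{-1},\gamma^{-1})$, and with the Haar system $\{\tau\times\lambda^u\}$, where $\tau$ (written $dt$) is the normalized Haar measure on $\mathbb T$ and the unit $(1,u)$ is identified with $u$. For a second-countable locally compact Hausdorff groupoid $E$ with Haar system $\beta$ and a continuous normalized 2-cocycle $\sigma$ on $E$, let $C_c(E,\sigma)$ be the $*$-algebra $C_c(E)$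 with $$f*g(\gamma)=\int_E f(\eta)\,g(\eta^{-1}\gamma)\,\sigma(\eta,\eta^{-1}\gamma)\,d\beta^{r(\gamma)}(\eta),\qquad f^*(\gamma)=\overline{f(\gamma^{-1})}\;\overline{\sigma(\gamma,\gamma^{-1})},$$ and let $C^*(E,\sigma)$ be its completion in $\|f\|=\sup_\rho\|\rho(f)\|$, where $\rho$ runs over the Hilbert-space representations of $C_c(E,\sigma)$ that are continuous for the inductive limit topology on $C_c(E)$ and the weak operator topology; write $C^*(E)=C^*(E,1)$. Then the suprema defining the norms of $C^*(G^\omega)$ and of $C^*(G,\omega^n)$, $n\in\mathbb Z$, are finite, and there is a $*$-isomorphism $\Upsilon$ of $C^*(G^\omega)$ onto the $c_0$-direct sum $\bigoplus_{n\in\mathbb Z}C^*(G,\omega^n)$ (the families $(a_n)_{n\in\mathbb Z}$ with $\|a_n\|\to0$ as $|n|\to\infty$) such that for all $F\in C_c(G^\omega)$ $$\Upsilon(F)=(\Upsilon_n(F))_{n\in\mathbb Z},\qquad \Upsilon_n(F)(\gamma)=\int_{\mathbb T}F(t,\gamma)\,t^n\,dt .$$ -/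

import Mathlib

open MeasureTheory Topology Filter
open scoped ENNReal CompactlySupported

universe u

noncomputable section

set_option linter.unusedSectionVars false

namespace GroupoidCStar

/-! ### Groupoids, given by their set of arrows

The product and the inverse are total functions; the product `γ * η` has a meaning only for
composable pairs, and no axiom says anything about it for other pairs. -/

/-- A groupoid with set of arrows `G`. The pair `(γ, η)` is composable when
`γ⁻¹ * γ = η * η⁻¹`, i.e. when the source of `γ` is the range of `η`. -/
class ArrowGroupoid (G : Type u) extends Mul G, Inv G where
  inv_inv' (γ : G) : (γ⁻¹)⁻¹ = γ
  range_mul' (γ η : G) : γ⁻¹ * γ = η * η⁻¹ → (γ * η) * (γ * η)⁻¹ = γ * γ⁻¹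
  source_mul' (γ η : G) : γ⁻¹ * γ = η * η⁻¹ → (γ * η)⁻¹ * (γ * η) = η⁻¹ * η
  assoc' (γ η ξ : G) : γ⁻¹ * γ = η * η⁻¹ → η⁻¹ * η = ξ * ξ⁻¹ →
    (γ * η) * ξ = γ * (η * ξ)
  inv_mul_cancel_left' (γ η : G) : γ⁻¹ * γ = η * η⁻¹ → γ⁻¹ * (γ * η) = η
  mul_inv_cancel_right' (γ η : G) : γ⁻¹ * γ = η * η⁻¹ → (γ * η) * η⁻¹ = γ

section Algebra

variable {G : Type u} [ArrowGroupoid G]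

/-- The range map. -/
def rng (γ : G) : G := γ * γ⁻¹

/-- The source map. -/
def src (γ : G) : G := γ⁻¹ * γ

/-- The set of composable pairs. -/
def composable (G : Type u) [ArrowGroupoid G] : Set (G × G) := {p | src p.1 = rng p.2}

/-- The unit space, as a subset of the set of arrows. -/
def unitSpace (G : Type u) [ArrowGroupoid G] : Set G := Set.range (rng : G → G)

/-- The range map, with values in the unit space. -/
def rngU (γ : G) : unitSpace G := ⟨rng γ, γ, rfl⟩

/-- The source map, with values in the unit space. -/
def srcU (γ : G) : unitSpace G :=
  ⟨src γ, γ⁻¹, by simp only [rng, src, ArrowGroupoid.inv_inv']⟩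

theorem inv_inv (γ : G) : (γ⁻¹)⁻¹ = γ := ArrowGroupoid.inv_inv' γ
theorem src_inv (γ : G) : src γ⁻¹ = rng γ := by simp only [rng, src, inv_inv]
theorem rng_inv (γ : G) : rng γ⁻¹ = src γ := by simp only [rng, src, inv_inv]
theorem rng_mul {γ η : G} (h : src γ = rng η) : rng (γ * η) = rng γ :=
  ArrowGroupoid.range_mul' γ η h
theorem src_mul {γ η : G} (h : src γ = rng η) : src (γ * η) = src η :=
  ArrowGroupoid.source_mul' γ η h
theorem mul_assoc' {γ η ξ : G} (h : src γ = rng η) (h' : src η = rng ξ) :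
    (γ * η) * ξ = γ * (η * ξ) := ArrowGroupoid.assoc' γ η ξ h h'
theorem inv_mul_cancel_left {γ η : G} (h : src γ = rng η) : γ⁻¹ * (γ * η) = η :=
  ArrowGroupoid.inv_mul_cancel_left' γ η h
theorem mul_inv_cancel_right {γ η : G} (h : src γ = rng η) : (γ * η) * η⁻¹ = γ :=
  ArrowGroupoid.mul_inv_cancel_right' γ η h
theorem mul_inv_cancel_left {γ η : G} (h : rng γ = rng η) : γ * (γ⁻¹ * η) = η := by
  have := inv_mul_cancel_left (γ := γ⁻¹) (η := η) (by rw [src_inv, h])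
  rwa [inv_inv] at this
theorem rng_mul_self (γ : G) : rng γ * γ = γ := by
  have := mul_inv_cancel_right (γ := γ) (η := γ⁻¹) (rng_inv γ).symm
  rwa [inv_inv] at this
theorem mul_src_self (γ : G) : γ * src γ = γ := mul_inv_cancel_left (γ := γ) (η := γ) rfl
theorem rng_rng (γ : G) : rng (rng γ) = rng γ := rng_mul (rng_inv γ).symm
theorem src_rng (γ : G) : src (rng γ) = rng γ :=
  (src_mul (rng_inv γ).symm).trans (src_inv γ)
theorem rng_src (γ : G) : rng (src γ) = src γ :=
  (rng_mul (src_inv γ)).trans (rng_inv γ)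

end Algebra

/-- A topological groupoid: inversion is continuous, and so is multiplication on the set of
composable pairs with the relative product topology. -/
class TopologicalGroupoid (G : Type u) [TopologicalSpace G] [ArrowGroupoid G] : Prop where
  continuous_inv : Continuous fun γ : G => γ⁻¹
  continuousOn_mul : ContinuousOn (fun p : G × G => p.1 * p.2) (composable G)

section Topological

variable {G : Type u} [TopologicalSpace G] [ArrowGroupoid G] [TopologicalGroupoid G]

theorem continuous_rng : Continuous (rng : G → G) :=
  TopologicalGroupoid.continuousOn_mul.comp_continuous
    (continuous_id.prodMk TopologicalGroupoid.continuous_inv) fun γ => (rng_inv γ).symm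

theorem continuous_src : Continuous (src : G → G) :=
  TopologicalGroupoid.continuousOn_mul.comp_continuous
    (TopologicalGroupoid.continuous_inv.prodMk continuous_id) fun γ => src_inv γ

theorem continuous_rngU : Continuous (rngU : G → unitSpace G) :=
  continuous_rng.subtype_mk _

theorem isClosed_composable [T2Space G] : IsClosed (composable G) :=
  isClosed_eq (continuous_src.comp continuous_fst) (continuous_rng.comp continuous_snd)

end Topological

/-- A (left) Haar system on a topological groupoid: Radon measures `λᵘ`, one for each unit `u`,
with support the range fibre of `u`, such that `u ↦ ∫ f dλᵘ` is continuous for `f ∈ C_c(G)`, and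
such that `∫ f(γη) dλ^{s(γ)}(η) = ∫ f(η) dλ^{r(γ)}(η)`. (On a second-countable locally compact
Hausdorff space a Borel measure is Radon if it is finite on compact sets.) -/
structure HaarSystem (G : Type u) [TopologicalSpace G] [ArrowGroupoid G]
    [MeasurableSpace G] where
  meas : unitSpace G → Measure G
  finite_on_compacts : ∀ u, IsFiniteMeasureOnCompacts (meas u)
  support_eq : ∀ u, (meas u).support = {γ | rngU γ = u}
  continuous_integral : ∀ f : C_c(G, ℂ), Continuous fun u => ∫ γ, f γ ∂(meas u)
  left_invariant : ∀ (γ : G) (f : C_c(G, ℂ)),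
    ∫ η, f (γ * η) ∂(meas (srcU γ)) = ∫ η, f η ∂(meas (rngU γ))

/-- A continuous normalized `2`-cocycle on `G` with values in the circle. Only its values on
composable pairs matter. -/
structure TwoCocycle (G : Type u) [TopologicalSpace G] [ArrowGroupoid G] where
  toFun : G → G → Circle
  continuousOn' : ContinuousOn (fun p : G × G => toFun p.1 p.2) (composable G)
  cocycle' : ∀ γ η ξ : G, src γ = rng η → src η = rng ξ →
    toFun γ η * toFun (γ * η) ξ = toFun η ξ * toFun γ (η * ξ)
  map_rng' : ∀ γ : G, toFun (rng γ) γ = 1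
  map_src' : ∀ γ : G, toFun γ (src γ) = 1

namespace TwoCocycle

variable {G : Type u} [TopologicalSpace G] [ArrowGroupoid G]

instance : CoeFun (TwoCocycle G) fun _ => G → G → Circle := ⟨TwoCocycle.toFun⟩

/-- The trivial cocycle. -/
instance : One (TwoCocycle G) where
  one :=
    { toFun := fun _ _ => 1
      continuousOn' := continuousOn_const
      cocycle' := by simp
      map_rng' := by simp
      map_src' := by simp }

/-- The pointwise integral power `ω ^ n` of a cocycle. -/
instance : Pow (TwoCocycle G) ℤ where
  pow ω n :=
    { toFun := fun γ η => ω γ η ^ n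
      continuousOn' := (continuous_zpow n).comp_continuousOn ω.continuousOn'
      cocycle' := fun γ η ξ h h' => by
        rw [← mul_zpow, ← mul_zpow, ω.cocycle' γ η ξ h h']
      map_rng' := fun γ => by rw [ω.map_rng', one_zpow]
      map_src' := fun γ => by rw [ω.map_src', one_zpow] }

theorem map_inv_comm (ω : TwoCocycle G) (γ : G) : ω γ γ⁻¹ = ω γ⁻¹ γ := by
  have h := ω.cocycle' γ γ⁻¹ γ (rng_inv γ).symm (src_inv γ)
  have h1 : ω (γ * γ⁻¹) γ = 1 := ω.map_rng' γ
  have h2 : ω γ (γ⁻¹ * γ) = 1 := ω.map_src' γ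
  rwa [h1, h2, mul_one, mul_one] at h

end TwoCocycle

/-! ### The twisted convolution and involution on `C_c(E)` -/

section Convolution

theorem continuous_circle_coe : Continuous fun z : Circle => (z : ℂ) := continuous_induced_dom

variable {E : Type u} [TopologicalSpace E] [ArrowGroupoid E] [MeasurableSpace E]

/-- `(f * g)(γ) = ∫ f(η) g(η⁻¹γ) σ(η, η⁻¹γ) dβ^{r(γ)}(η)`. -/
def convFun (β : HaarSystem E) (σ : TwoCocycle E) (f g : E → ℂ) (γ : E) : ℂ :=
  ∫ η, f η * g (η⁻¹ * γ) * (σ η (η⁻¹ * γ) : ℂ) ∂(β.meas (rngU γ))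

/-- `f^*(γ) = conj f(γ⁻¹) · conj σ(γ, γ⁻¹)`. -/
def involFun (σ : TwoCocycle E) (f : E → ℂ) (γ : E) : ℂ :=
  (starRingEnd ℂ) (f γ⁻¹) * (starRingEnd ℂ) (σ γ γ⁻¹ : ℂ)

variable [TopologicalGroupoid E] [SecondCountableTopology E] [LocallyCompactSpace E] [T2Space E]
  [BorelSpace E]

theorem HaarSystem.ae_rngU (β : HaarSystem E) (u : unitSpace E) :
    ∀ᵐ γ ∂(β.meas u), rngU γ = u := by
  have h : (β.meas u).support ∈ ae (β.meas u) := Measure.support_mem_ae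
  rw [β.support_eq] at h
  exact h

/-- Integrals over the range fibres of a continuous compactly supported function of two variables
depend continuously on the first variable. -/
theorem HaarSystem.continuous_integral_fibre (β : HaarSystem E) (Φ : E → E → ℂ)
    (hΦ : Continuous (Function.uncurry Φ)) {K : Set E} (hK : IsCompact K)
    (h0 : ∀ γ, ∀ η ∉ K, Φ γ η = 0) :
    Continuous fun γ => ∫ η, Φ γ η ∂(β.meas (rngU γ)) := by
  obtain ⟨χ, hχ1, -, hχc, hχ01⟩ :=
    exists_continuous_one_zero_of_isCompact hK isClosed_empty (Set.disjoint_empty K)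
  let χc : C_c(E, ℂ) := ⟨⟨fun x => (χ x : ℂ), by fun_prop⟩,
    hχc.comp_left (g := fun x : ℝ => (x : ℂ)) Complex.ofReal_zero⟩
  have hint : ∀ u (f : E → ℂ), Continuous f → (∀ η ∉ K, f η = 0) →
      Integrable f (β.meas u) := by
    intro u f hf hf0
    have := β.finite_on_compacts u
    exact hf.integrable_of_hasCompactSupport (HasCompactSupport.intro hK hf0)
  have hχint : ∀ u, Integrable (fun x => χ x) (β.meas u) := fun u => by
    have := β.finite_on_compacts u
    exact χ.continuous.integrable_of_hasCompactSupport hχc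
  have hχcont : Continuous fun γ : E => ∫ x, χ x ∂(β.meas (rngU γ)) := by
    have h := Complex.continuous_re.comp ((β.continuous_integral χc).comp continuous_rngU)
    refine h.congr fun γ => ?_
    change (∫ x, ((χ x : ℝ) : ℂ) ∂(β.meas (rngU γ))).re = _
    rw [integral_complex_ofReal, Complex.ofReal_re]
  have hsec : ∀ γ, Continuous (Φ γ) := fun γ => hΦ.comp (Continuous.prodMk_right γ)
  rw [continuous_iff_continuousAt]
  intro γ₀
  have hA : Tendsto (fun γ : E => ∫ η, Φ γ₀ η ∂(β.meas (rngU γ))) (𝓝 γ₀)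
      (𝓝 (∫ η, Φ γ₀ η ∂(β.meas (rngU γ₀)))) := by
    let φ : C_c(E, ℂ) := ⟨⟨Φ γ₀, hsec γ₀⟩, HasCompactSupport.intro hK (h0 γ₀)⟩
    exact ((β.continuous_integral φ).comp continuous_rngU).continuousAt
  have hB : Tendsto (fun γ : E => ∫ η, (Φ γ η - Φ γ₀ η) ∂(β.meas (rngU γ))) (𝓝 γ₀)
      (𝓝 0) := by
    rw [Metric.tendsto_nhds]
    intro ε hε
    set M := ∫ x, χ x ∂(β.meas (rngU γ₀)) with hM
    have hM0 : 0 ≤ M := integral_nonneg fun x => (hχ01 x).1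
    have hM1 : ∀ᶠ γ in 𝓝 γ₀, ∫ x, χ x ∂(β.meas (rngU γ)) < M + 1 :=
      hχcont.continuousAt.eventually (gt_mem_nhds (by linarith))
    have hδ : 0 < ε / (M + 1) := by positivity
    have hu : ∀ᶠ γ in 𝓝 γ₀, ∀ η ∈ K, ‖Φ γ η - Φ γ₀ η‖ < ε / (M + 1) := by
      refine hK.eventually_forall_of_forall_eventually fun η _ => ?_
      have hc : Continuous fun p : E × E => ‖Φ p.1 p.2 - Φ γ₀ p.2‖ :=
        (hΦ.sub ((hsec γ₀).comp continuous_snd)).norm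
      refine hc.continuousAt.eventually (gt_mem_nhds ?_)
      simpa using hδ
    filter_upwards [hM1, hu] with γ h1 h2
    rw [dist_zero_right]
    calc ‖∫ η, (Φ γ η - Φ γ₀ η) ∂(β.meas (rngU γ))‖
        ≤ ∫ η, ε / (M + 1) * χ η ∂(β.meas (rngU γ)) := by
          refine norm_integral_le_of_norm_le ((hχint _).const_mul _) (Eventually.of_forall ?_)
          intro η
          by_cases hη : η ∈ K
          · have : χ η = 1 := hχ1 hη
            rw [this, mul_one]
            exact (h2 η hη).le
          · rw [h0 γ η hη, h0 γ₀ η hη, sub_zero, norm_zero]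
            exact mul_nonneg hδ.le (hχ01 η).1
      _ = ε / (M + 1) * ∫ η, χ η ∂(β.meas (rngU γ)) := integral_const_mul _ _
      _ < ε / (M + 1) * (M + 1) := mul_lt_mul_of_pos_left h1 hδ
      _ = ε := by field_simp
  have := hB.add hA
  rw [zero_add] at this
  refine this.congr fun γ => ?_
  rw [integral_sub (hint _ _ (hsec γ) (h0 γ)) (hint _ _ (hsec γ₀) (h0 γ₀))]
  ring

/-- The product of the supports of `f` and `g`. -/
def suppMul (f g : C_c(E, ℂ)) : Set E :=
  (fun p : E × E => p.1 * p.2) '' ((tsupport f ×ˢ tsupport g) ∩ composable E)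

theorem isCompact_suppMul (f g : C_c(E, ℂ)) : IsCompact (suppMul f g) :=
  ((f.hasCompactSupport.isCompact.prod g.hasCompactSupport.isCompact).inter_right
    isClosed_composable).image_of_continuousOn
    (TopologicalGroupoid.continuousOn_mul.mono Set.inter_subset_right)

theorem mem_suppMul (f g : C_c(E, ℂ)) {γ η : E} (h : rng η = rng γ)
    (hne : f η * g (η⁻¹ * γ) ≠ 0) : γ ∈ suppMul f g ∧ η ∈ tsupport f := by
  have hf : η ∈ tsupport f := subset_tsupport _ (left_ne_zero_of_mul hne)
  have hg : η⁻¹ * γ ∈ tsupport g := subset_tsupport _ (right_ne_zero_of_mul hne)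
  refine ⟨⟨(η, η⁻¹ * γ), ⟨⟨hf, hg⟩, ?_⟩, mul_inv_cancel_left h⟩, hf⟩
  change src η = rng (η⁻¹ * γ)
  rw [rng_mul (by rw [src_inv, h]), rng_inv]

theorem convFun_eq_zero (β : HaarSystem E) (σ : TwoCocycle E) (f g : C_c(E, ℂ)) {γ : E}
    (hγ : γ ∉ suppMul f g) : convFun β σ f g γ = 0 := by
  refine integral_eq_zero_of_ae ?_
  filter_upwards [β.ae_rngU (rngU γ)] with η hη
  by_contra hne
  exact hγ (mem_suppMul f g (congrArg Subtype.val hη) (left_ne_zero_of_mul hne)).1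

theorem continuous_convFun (β : HaarSystem E) (σ : TwoCocycle E) (f g : C_c(E, ℂ)) :
    Continuous (convFun β σ f g) := by
  set D : Set (E × E) := {p | rng p.2 = rng p.1} with hD
  have hDc : IsClosed D := isClosed_eq (continuous_rng.comp continuous_snd)
    (continuous_rng.comp continuous_fst)
  let Ψ : E × E → ℂ := fun p => f p.2 * g (p.2⁻¹ * p.1) * (σ p.2 (p.2⁻¹ * p.1) : ℂ)
  have hinv : Continuous fun γ : E => γ⁻¹ := TopologicalGroupoid.continuous_inv
  have hm : ContinuousOn (fun p : E × E => p.2⁻¹ * p.1) D :=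
    TopologicalGroupoid.continuousOn_mul.comp
      ((hinv.comp continuous_snd).prodMk continuous_fst).continuousOn
      (fun p hp => by change src p.2⁻¹ = rng p.1; rw [src_inv]; exact hp)
  have hσ : ContinuousOn (fun p : E × E => (σ p.2 (p.2⁻¹ * p.1) : ℂ)) D := by
    refine continuous_circle_coe.comp_continuousOn
      (σ.continuousOn'.comp (continuous_snd.continuousOn.prodMk hm) fun p hp => ?_)
    change src p.2 = rng (p.2⁻¹ * p.1)
    rw [rng_mul (by rw [src_inv]; exact hp), rng_inv]
  have hΨ : ContinuousOn Ψ D :=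
    ((f.continuous.comp continuous_snd).continuousOn.mul
      (g.continuous.comp_continuousOn hm)).mul hσ
  obtain ⟨Θ, hΘ⟩ := ContinuousMap.exists_restrict_eq hDc
    (⟨D.domRestrict Ψ, continuousOn_iff_continuous_domRestrict.1 hΨ⟩ : C(D, ℂ))
  have hΘ' : ∀ p ∈ D, Θ p = Ψ p := fun p hp => DFunLike.congr_fun hΘ ⟨p, hp⟩
  obtain ⟨χ, hχ1, -, hχc, -⟩ := exists_continuous_one_zero_of_isCompact
    ((isCompact_suppMul f g).prod f.hasCompactSupport.isCompact) isClosed_empty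
    (Set.disjoint_empty _)
  have hK : IsCompact (Prod.snd '' tsupport χ) := hχc.isCompact.image continuous_snd
  have key := β.continuous_integral_fibre (fun γ η => (χ (γ, η) : ℂ) * Θ (γ, η))
    (by
      have : Continuous fun p : E × E => (χ p : ℂ) * Θ p := by fun_prop
      exact this) hK
    (fun γ η hη => by
      have : χ (γ, η) = 0 := by
        by_contra hne
        exact hη ⟨(γ, η), subset_tsupport _ hne, rfl⟩
      simp [this])
  refine key.congr fun γ => integral_congr_ae ?_
  filter_upwards [β.ae_rngU (rngU γ)] with η hη
  have hη' : rng η = rng γ := congrArg Subtype.val hη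
  have hp : ((γ, η) : E × E) ∈ D := hη'
  rw [hΘ' _ hp]
  by_cases hz : f η * g (η⁻¹ * γ) = 0
  · simp [Ψ, hz]
  · have h1 := mem_suppMul f g hη' hz
    have : χ (γ, η) = 1 := hχ1 (Set.mk_mem_prod h1.1 h1.2)
    simp [Ψ, this]

/-- The twisted convolution product on `C_c(E, σ)`. -/
def conv (β : HaarSystem E) (σ : TwoCocycle E) (f g : C_c(E, ℂ)) : C_c(E, ℂ) where
  toFun := convFun β σ f g
  continuous_toFun := continuous_convFun β σ f g
  hasCompactSupport' := HasCompactSupport.intro (isCompact_suppMul f g)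
    fun _ h => convFun_eq_zero β σ f g h

theorem hasCompactSupport_involFun (σ : TwoCocycle E) (f : C_c(E, ℂ)) :
    HasCompactSupport (involFun σ f) := by
  refine HasCompactSupport.intro
    (f.hasCompactSupport.isCompact.image (TopologicalGroupoid.continuous_inv (G := E))) ?_
  intro γ hγ
  have : f γ⁻¹ = 0 := by
    by_contra hne
    exact hγ ⟨γ⁻¹, subset_tsupport _ hne, inv_inv γ⟩
  simp [involFun, this]

/-- The twisted involution on `C_c(E, σ)`. -/
def invol (σ : TwoCocycle E) (f : C_c(E, ℂ)) : C_c(E, ℂ) where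
  toFun := involFun σ f
  continuous_toFun := by
    have hinv : Continuous fun γ : E => γ⁻¹ := TopologicalGroupoid.continuous_inv
    refine (Complex.continuous_conj.comp (f.continuous.comp hinv)).mul
      (Complex.continuous_conj.comp (continuous_circle_coe.comp ?_))
    exact σ.continuousOn'.comp_continuous (continuous_id.prodMk hinv) fun γ => (rng_inv γ).symm
  hasCompactSupport' := hasCompactSupport_involFun σ f

end Convolution

/-! ### The inductive limit topology -/

section InductiveLimit

variable (E : Type u) [TopologicalSpace E]

/-- The inductive limit topology on `C_c(E)`: the finest locally convex vector space topology for
which, for every compact `K ⊆ E`, the inclusion into `C_c(E)` of the space `C_K(E)` of functions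
with support in `K`, with the topology of uniform convergence, is continuous. -/
@[reducible] def inductiveLimitTopology : TopologicalSpace C_c(E, ℂ) :=
  sInf {t : TopologicalSpace C_c(E, ℂ) |
    @IsTopologicalAddGroup C_c(E, ℂ) t _ ∧ @ContinuousSMul ℂ C_c(E, ℂ) _ _ t ∧
    @LocallyConvexSpace ℝ C_c(E, ℂ) _ _ _ _ t ∧
    ∀ K : Set E, IsCompact K →
      @Continuous {f : C_c(E, ℂ) // tsupport f ⊆ K} C_c(E, ℂ)
        (TopologicalSpace.induced (fun f => f.1.toBoundedContinuousFunction) inferInstance) t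
        Subtype.val}

end InductiveLimit

/-! ### Representations and the full twisted groupoid `C*`-algebra -/

section FullCStar

variable {E : Type u} [TopologicalSpace E] [ArrowGroupoid E] [TopologicalGroupoid E]
  [SecondCountableTopology E] [LocallyCompactSpace E] [T2Space E] [MeasurableSpace E]
  [BorelSpace E]

/-- A representation of the `*`-algebra `C_c(E, σ)` on a Hilbert space `H`, continuous for the
inductive limit topology on `C_c(E)` and the weak operator topology on `B(H)`. -/
structure Rep (β : HaarSystem E) (σ : TwoCocycle E) where
  H : Type u
  [normedAddCommGroup : NormedAddCommGroup H]
  [innerProductSpace : InnerProductSpace ℂ H]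
  [completeSpace : CompleteSpace H]
  toLin : C_c(E, ℂ) →ₗ[ℂ] (H →L[ℂ] H)
  map_conv : ∀ f g, toLin (conv β σ f g) = toLin f * toLin g
  map_invol : ∀ f, toLin (invol σ f) = star (toLin f)
  continuous_wot : @Continuous C_c(E, ℂ) (H →WOT[ℂ] H) (inductiveLimitTopology E) _
    fun f => ContinuousLinearMapWOT.ofCLM (toLin f)

attribute [instance] Rep.normedAddCommGroup Rep.innerProductSpace Rep.completeSpace

/-- The algebra of bounded operators on the space of a representation. -/
abbrev Rep.Op {β : HaarSystem E} {σ : TwoCocycle E} (ρ : Rep β σ) : Type u := ρ.H →L[ℂ] ρ.H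

/-- `sup {‖ρ(f)‖ : ρ ∈ Rep(C_c(E, σ))}` is finite. -/
def FiniteNorm (β : HaarSystem E) (σ : TwoCocycle E) (f : C_c(E, ℂ)) : Prop :=
  BddAbove (Set.range fun ρ : Rep β σ => ‖ρ.toLin f‖)

/-- The image of `C_c(E, σ)` in the `C*`-algebra `∏_ρ B(H_ρ)` of bounded families, under
`f ↦ (ρ(f))_ρ`. The norm of the image of `f` is `sup_ρ ‖ρ(f)‖`. -/
def universalImage (β : HaarSystem E) (σ : TwoCocycle E) :
    NonUnitalStarSubalgebra ℂ (lp (fun ρ : Rep β σ => ρ.Op) ∞) where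
  carrier := {a | ∃ f : C_c(E, ℂ), ∀ ρ : Rep β σ, a ρ = ρ.toLin f}
  add_mem' := by
    rintro a b ⟨f, hf⟩ ⟨g, hg⟩
    refine ⟨f + g, fun ρ => ?_⟩
    rw [lp.coeFn_add, Pi.add_apply, hf, hg, map_add]
  zero_mem' := ⟨0, fun ρ => by rw [lp.coeFn_zero, Pi.zero_apply, map_zero]⟩
  mul_mem' := by
    rintro a b ⟨f, hf⟩ ⟨g, hg⟩
    refine ⟨conv β σ f g, fun ρ => ?_⟩
    rw [lp.infty_coeFn_mul, Pi.mul_apply, hf, hg, ρ.map_conv]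
  smul_mem' := by
    rintro c a ⟨f, hf⟩
    refine ⟨c • f, fun ρ => ?_⟩
    rw [lp.coeFn_smul, Pi.smul_apply, hf, map_smul]
  star_mem' := by
    rintro a ⟨f, hf⟩
    refine ⟨invol σ f, fun ρ => ?_⟩
    rw [lp.star_apply, hf, ρ.map_invol]

/-- The bounded family `(ρ(f))_ρ`, for `f ∈ C_c(E, σ)` of finite norm. -/
def boundedFamily (β : HaarSystem E) (σ : TwoCocycle E) (f : C_c(E, ℂ))
    (h : FiniteNorm β σ f) : lp (fun ρ : Rep β σ => ρ.Op) ∞ :=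
  ⟨fun ρ : Rep β σ => (ρ.toLin f : ρ.Op), memℓp_infty h⟩

/-- The full twisted groupoid `C*`-algebra `C*(E, σ)`: the completion of `C_c(E, σ)` in the norm
`‖f‖ = sup_ρ ‖ρ(f)‖`, realized as the closure of the image of `C_c(E, σ)` in the product of
the `B(H_ρ)`. -/
def CStar (β : HaarSystem E) (σ : TwoCocycle E) : Type (u + 1) :=
  (universalImage β σ).topologicalClosure

/-- An element of the closure of the image of `C_c(E, σ)`, as an element of `C*(E, σ)`. -/
def CStar.ofMem {β : HaarSystem E} {σ : TwoCocycle E} (a : lp (fun ρ : Rep β σ => ρ.Op) ∞)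
    (ha : a ∈ (universalImage β σ).topologicalClosure) : CStar β σ := ⟨a, ha⟩

instance (β : HaarSystem E) (σ : TwoCocycle E) : NonUnitalCStarAlgebra (CStar β σ) :=
  NonUnitalStarSubalgebra.nonUnitalCStarAlgebra (universalImage β σ).topologicalClosure
    (h_closed := (universalImage β σ).isClosed_topologicalClosure)

open Classical in
/-- The canonical map `C_c(E, σ) → C*(E, σ)`, with the value `0` at an `f` whose norm is not
finite (there are no such `f`). -/
def toCStar (β : HaarSystem E) (σ : TwoCocycle E) (f : C_c(E, ℂ)) : CStar β σ :=
  if h : FiniteNorm β σ f then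
    CStar.ofMem (boundedFamily β σ f h)
      ((universalImage β σ).le_topologicalClosure ⟨f, fun _ => rfl⟩)
  else 0

theorem norm_toCStar (β : HaarSystem E) (σ : TwoCocycle E) {f : C_c(E, ℂ)}
    (h : FiniteNorm β σ f) : ‖toCStar β σ f‖ = ⨆ ρ : Rep β σ, ‖ρ.toLin f‖ := by
  rw [toCStar, dif_pos h]
  exact lp.norm_eq_ciSup _

theorem denseRange_toCStar (β : HaarSystem E) (σ : TwoCocycle E) :
    DenseRange (toCStar β σ) := by
  have key : ∀ b : (universalImage β σ).topologicalClosure,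
      b.1 ∈ universalImage β σ → CStar.ofMem b.1 b.2 ∈ Set.range (toCStar β σ) := by
    rintro ⟨b, hb⟩ ⟨f, hf⟩
    have hfin : FiniteNorm β σ f := by
      refine ⟨‖b‖, ?_⟩
      rintro _ ⟨ρ, rfl⟩
      change ‖ρ.toLin f‖ ≤ _
      rw [← hf ρ]
      exact lp.norm_apply_le_norm ENNReal.top_ne_zero b ρ
    refine ⟨f, ?_⟩
    rw [toCStar, dif_pos hfin]
    exact Subtype.ext (lp.ext (funext fun ρ => (hf ρ).symm))
  have hd : Dense (Subtype.val ⁻¹' (universalImage β σ : Set (lp (fun ρ : Rep β σ => ρ.Op) ∞)) :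
      Set (universalImage β σ).topologicalClosure) := by
    intro b
    rw [closure_subtype]
    refine closure_mono ?_ b.2
    exact fun c hc => ⟨⟨c, (universalImage β σ).le_topologicalClosure hc⟩, hc, rfl⟩
  exact hd.mono fun b hb => key b hb

end FullCStar

/-- The (`c₀`-)direct sum `⊕ᵢ Aᵢ` of a family of `C*`-algebras: the families with
`‖aᵢ‖ → 0`, with pointwise operations and the supremum norm. -/
def directSum {I : Type*} (A : I → Type*) [∀ i, NonUnitalCStarAlgebra (A i)] :
    NonUnitalStarSubalgebra ℂ (lp A ∞) where
  carrier := {a | Tendsto (fun i => ‖a i‖) cofinite (𝓝 0)}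
  add_mem' := by
    intro a b ha hb
    refine squeeze_zero (fun i => norm_nonneg _) (fun i => norm_add_le (a i) (b i)) ?_
    simpa using Tendsto.add ha hb
  zero_mem' := by
    change Tendsto (fun i => ‖(0 : A i)‖) cofinite (𝓝 0)
    simp only [norm_zero]
    exact tendsto_const_nhds
  mul_mem' := by
    intro a b ha hb
    refine squeeze_zero (fun i => norm_nonneg _) (fun i => norm_mul_le (a i) (b i)) ?_
    simpa using Tendsto.mul ha hb
  smul_mem' := by
    intro c a ha
    refine squeeze_zero (fun i => norm_nonneg _) (fun i => norm_smul_le c (a i)) ?_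
    simpa using Tendsto.const_mul ‖c‖ ha
  star_mem' := by
    intro a ha
    change Tendsto (fun i => ‖star (a i)‖) cofinite (𝓝 0)
    simp only [norm_star]
    exact ha

/-! ### The extension of `G` by the circle defined by a cocycle -/

instance : MeasurableSpace Circle := borel Circle
instance : BorelSpace Circle := ⟨rfl⟩

/-- The normalized Haar measure on the circle. -/
def circleHaar : Measure Circle := Measure.haarMeasure ⊤

instance : circleHaar.IsHaarMeasure := Measure.isHaarMeasure_haarMeasure _
instance : IsProbabilityMeasure circleHaar := ⟨by
  have := Measure.haarMeasure_self (K₀ := (⊤ : TopologicalSpace.PositiveCompacts Circle))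
  simpa [circleHaar] using this⟩

/-- The set of arrows `𝕋 × G` of the extension `G^ω`. -/
def Ext {G : Type u} [TopologicalSpace G] [ArrowGroupoid G] (_ω : TwoCocycle G) : Type u :=
  Circle × G

namespace Ext

section Algebra

variable {G : Type u} [TopologicalSpace G] [ArrowGroupoid G]

/-- The element `(t, γ)` of `G^ω`. -/
def mk (ω : TwoCocycle G) (t : Circle) (γ : G) : Ext ω := Prod.mk t γ

/-- The component of an element of `G^ω` in the circle. -/
def circ {ω : TwoCocycle G} (a : Ext ω) : Circle := Prod.fst (α := Circle) (β := G) a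

/-- The component of an element of `G^ω` in `G`. -/
def arr {ω : TwoCocycle G} (a : Ext ω) : G := Prod.snd (α := Circle) (β := G) a

variable (ω : TwoCocycle G)

instance : TopologicalSpace (Ext ω) := inferInstanceAs (TopologicalSpace (Circle × G))
instance [MeasurableSpace G] : MeasurableSpace (Ext ω) :=
  inferInstanceAs (MeasurableSpace (Circle × G))
instance [T2Space G] : T2Space (Ext ω) := inferInstanceAs (T2Space (Circle × G))
instance [SecondCountableTopology G] : SecondCountableTopology (Ext ω) :=
  inferInstanceAs (SecondCountableTopology (Circle × G))
instance [LocallyCompactSpace G] : LocallyCompactSpace (Ext ω) :=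
  inferInstanceAs (LocallyCompactSpace (Circle × G))
instance [SecondCountableTopology G] [MeasurableSpace G] [BorelSpace G] : BorelSpace (Ext ω) :=
  inferInstanceAs (BorelSpace (Circle × G))

instance : Mul (Ext ω) := ⟨fun a b => mk ω (a.circ * b.circ * ω a.arr b.arr) (a.arr * b.arr)⟩
instance : Inv (Ext ω) := ⟨fun a => mk ω (a.circ⁻¹ * (ω a.arr a.arr⁻¹)⁻¹) a.arr⁻¹⟩

variable {ω}

theorem ext {a b : Ext ω} (h : a.circ = b.circ) (h' : a.arr = b.arr) : a = b :=
  Prod.ext (α := Circle) (β := G) h h'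

theorem continuous_circ : Continuous (circ : Ext ω → Circle) :=
  continuous_fst (X := Circle) (Y := G)

theorem continuous_arr : Continuous (arr : Ext ω → G) :=
  continuous_snd (X := Circle) (Y := G)

theorem continuous_mk : Continuous fun p : Circle × G => mk ω p.1 p.2 := continuous_id

theorem mul_def (a b : Ext ω) : a * b = mk ω (a.circ * b.circ * ω a.arr b.arr) (a.arr * b.arr) := rfl
theorem inv_def (a : Ext ω) : a⁻¹ = mk ω (a.circ⁻¹ * (ω a.arr a.arr⁻¹)⁻¹) a.arr⁻¹ := rfl

theorem mul_inv_eq (a : Ext ω) : a * a⁻¹ = mk ω 1 (rng a.arr) :=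
  Ext.ext (by
    change a.circ * (a.circ⁻¹ * (ω a.arr a.arr⁻¹)⁻¹) * ω a.arr a.arr⁻¹ = 1
    rw [_root_.mul_inv_cancel_left, inv_mul_cancel]) rfl

theorem inv_mul_eq (a : Ext ω) : a⁻¹ * a = mk ω 1 (src a.arr) :=
  Ext.ext (by
    change a.circ⁻¹ * (ω a.arr a.arr⁻¹)⁻¹ * a.circ * ω a.arr⁻¹ a.arr = 1
    rw [← ω.map_inv_comm, mul_right_comm, _root_.inv_mul_cancel_right, inv_mul_cancel]) rfl

theorem composable_iff (a b : Ext ω) : a⁻¹ * a = b * b⁻¹ ↔ src a.arr = rng b.arr := by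
  rw [inv_mul_eq, mul_inv_eq]
  exact ⟨fun h => congrArg arr h, fun h => Ext.ext rfl h⟩

theorem inv_inv_eq (a : Ext ω) : (a⁻¹)⁻¹ = a :=
  Ext.ext (by
    change (a.circ⁻¹ * (ω a.arr a.arr⁻¹)⁻¹)⁻¹ * (ω a.arr⁻¹ (a.arr⁻¹)⁻¹)⁻¹ = a.circ
    rw [GroupoidCStar.inv_inv, ← ω.map_inv_comm, mul_inv, _root_.inv_inv, _root_.inv_inv,
      _root_.mul_inv_cancel_right]) (GroupoidCStar.inv_inv a.arr)

theorem assoc_eq {a b c : Ext ω} (h : src a.arr = rng b.arr) (h' : src b.arr = rng c.arr) :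
    (a * b) * c = a * (b * c) :=
  Ext.ext (by
    change a.circ * b.circ * ω a.arr b.arr * c.circ * ω (a.arr * b.arr) c.arr
      = a.circ * (b.circ * c.circ * ω b.arr c.arr) * ω a.arr (b.arr * c.arr)
    have := ω.cocycle' _ _ _ h h'
    calc _ = a.circ * b.circ * c.circ * (ω a.arr b.arr * ω (a.arr * b.arr) c.arr) := by
            simp only [mul_assoc, mul_left_comm, mul_comm]
      _ = a.circ * b.circ * c.circ * (ω b.arr c.arr * ω a.arr (b.arr * c.arr)) := by rw [this]
      _ = _ := by simp only [mul_assoc]) (GroupoidCStar.mul_assoc' h h')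

theorem unit_mul (a : Ext ω) : mk ω 1 (rng a.arr) * a = a :=
  Ext.ext (by
    change 1 * a.circ * ω (rng a.arr) a.arr = a.circ
    rw [ω.map_rng', one_mul, mul_one]) (rng_mul_self a.arr)

theorem mul_unit (a : Ext ω) : a * mk ω 1 (src a.arr) = a :=
  Ext.ext (by
    change a.circ * 1 * ω a.arr (src a.arr) = a.circ
    rw [ω.map_src', mul_one, mul_one]) (mul_src_self a.arr)

/-- The groupoid `G^ω = 𝕋 ×_ω G`, with `(s, η)(t, γ) = (s t ω(η, γ), ηγ)` and
`(t, γ)⁻¹ = (t⁻¹ ω(γ, γ⁻¹)⁻¹, γ⁻¹)`. -/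
instance : ArrowGroupoid (Ext ω) where
  inv_inv' := inv_inv_eq
  range_mul' a b h := by
    rw [composable_iff] at h
    rw [mul_inv_eq, mul_inv_eq]
    exact Ext.ext rfl (rng_mul h)
  source_mul' a b h := by
    rw [composable_iff] at h
    rw [inv_mul_eq, inv_mul_eq]
    exact Ext.ext rfl (src_mul h)
  assoc' a b c h h' := by
    rw [composable_iff] at h h'
    exact assoc_eq h h'
  inv_mul_cancel_left' a b h := by
    rw [composable_iff] at h
    rw [← assoc_eq (a := a⁻¹) (src_inv a.arr) h, inv_mul_eq, h, unit_mul]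
  mul_inv_cancel_right' a b h := by
    rw [composable_iff] at h
    rw [assoc_eq (c := b⁻¹) h (rng_inv b.arr).symm, mul_inv_eq, ← h, mul_unit]

theorem rng_def (a : Ext ω) : rng a = mk ω 1 (rng a.arr) := mul_inv_eq a
theorem src_def (a : Ext ω) : src a = mk ω 1 (src a.arr) := inv_mul_eq a

theorem mem_composable (p : Ext ω × Ext ω) :
    p ∈ composable (Ext ω) ↔ (p.1.arr, p.2.arr) ∈ composable G :=
  composable_iff p.1 p.2

/-- The identification `(1, u) ↦ u` of the unit space of `G^ω` with that of `G`. -/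
def unitProj (v : unitSpace (Ext ω)) : unitSpace G :=
  ⟨v.1.arr, by
    obtain ⟨_, a, rfl⟩ := v
    exact ⟨a.arr, (congrArg arr (rng_def a)).symm⟩⟩

theorem unitProj_rngU (a : Ext ω) : unitProj (rngU a) = rngU a.arr :=
  Subtype.ext (congrArg arr (rng_def a))

theorem unitProj_srcU (a : Ext ω) : unitProj (srcU a) = srcU a.arr :=
  Subtype.ext (congrArg arr (src_def a))

theorem unitProj_injective : Function.Injective (unitProj (ω := ω)) := by
  rintro ⟨_, a, rfl⟩ ⟨_, b, rfl⟩ h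
  have h' : (rng a).arr = (rng b).arr := congrArg Subtype.val h
  refine Subtype.ext ?_
  change rng a = rng b
  rw [rng_def, rng_def] at h' ⊢
  exact Ext.ext rfl h'

theorem continuous_unitProj : Continuous (unitProj (ω := ω)) :=
  (continuous_arr.comp continuous_subtype_val).subtype_mk _

theorem continuousOn_mul [TopologicalGroupoid G] :
    ContinuousOn (fun p : Ext ω × Ext ω => p.1 * p.2) (composable (Ext ω)) := by
  have hπ : Continuous fun p : Ext ω × Ext ω => (p.1.arr, p.2.arr) :=
    (continuous_arr.comp continuous_fst).prodMk (continuous_arr.comp continuous_snd)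
  have hmaps : Set.MapsTo (fun p : Ext ω × Ext ω => (p.1.arr, p.2.arr))
      (composable (Ext ω)) (composable G) := fun p hp => (mem_composable p).1 hp
  have h1 : ContinuousOn (fun p : Ext ω × Ext ω => ω p.1.arr p.2.arr)
      (composable (Ext ω)) := ω.continuousOn'.comp hπ.continuousOn hmaps
  have h2 : ContinuousOn (fun p : Ext ω × Ext ω => p.1.arr * p.2.arr)
      (composable (Ext ω)) :=
    TopologicalGroupoid.continuousOn_mul.comp hπ.continuousOn hmaps
  have h3 : Continuous fun p : Ext ω × Ext ω => p.1.circ * p.2.circ :=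
    (continuous_circ.comp continuous_fst).mul (continuous_circ.comp continuous_snd)
  exact continuous_mk.comp_continuousOn ((h3.continuousOn.mul h1).prodMk h2)

instance [TopologicalGroupoid G] : TopologicalGroupoid (Ext ω) where
  continuous_inv := by
    have hinv : Continuous fun γ : G => γ⁻¹ := TopologicalGroupoid.continuous_inv
    have hω : Continuous fun γ : G => ω γ γ⁻¹ :=
      ω.continuousOn'.comp_continuous (continuous_id.prodMk hinv) fun γ => (rng_inv γ).symm
    exact continuous_mk.comp
      ((continuous_circ.inv.mul (hω.comp continuous_arr).inv).prodMk (hinv.comp continuous_arr))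
  continuousOn_mul := continuousOn_mul

/-- `Υ_n(F)(γ) = ∫_𝕋 F(t, γ) tⁿ dt`, as a map `C_c(G^ω) → C_c(G)`. -/
def upsilon [T2Space G] [FirstCountableTopology G] [LocallyCompactSpace G] (n : ℤ)
    (F : C_c(Ext ω, ℂ)) : C_c(G, ℂ) where
  toFun := fun γ => ∫ t : Circle, F (mk ω t γ) * ((t ^ n : Circle) : ℂ) ∂circleHaar
  continuous_toFun := by
    have hF : Continuous fun p : Circle × G => F (mk ω p.1 p.2) :=
    F.continuous.comp continuous_mk
    have : Continuous (Function.uncurry fun (γ : G) (t : Circle) =>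
        F (mk ω t γ) * ((t ^ n : Circle) : ℂ)) :=
      (hF.comp (continuous_snd.prodMk continuous_fst)).mul
        (continuous_circle_coe.comp ((continuous_zpow n).comp continuous_snd))
    simpa only [setIntegral_univ] using continuous_parametric_integral_of_continuous
      (μ := circleHaar) this isCompact_univ
  hasCompactSupport' := by
    refine HasCompactSupport.intro 
      (F.hasCompactSupport.isCompact.image continuous_arr) ?_
    intro γ hγ
    have : ∀ t : Circle, F (mk ω t γ) = 0 := fun t => by
      by_contra hne
      exact hγ ⟨mk ω t γ, subset_tsupport _ hne, rfl⟩
    simp [this]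

end Algebra

section Haar

variable {G : Type u} [TopologicalSpace G] [ArrowGroupoid G] [TopologicalGroupoid G]
  [SecondCountableTopology G] [LocallyCompactSpace G] [T2Space G] [MeasurableSpace G]
  [BorelSpace G] {ω : TwoCocycle G}

theorem upsilon_zero_apply (F : C_c(Ext ω, ℂ)) (γ : G) :
    upsilon 0 F γ = ∫ t : Circle, F (mk ω t γ) ∂circleHaar := by
  change ∫ t : Circle, F (mk ω t γ) * ((t ^ (0 : ℤ) : Circle) : ℂ) ∂circleHaar = _
  simp

theorem integral_prod_eq (μ : Measure G) [IsFiniteMeasureOnCompacts μ] (F : C_c(Ext ω, ℂ)) :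
    ∫ p : Circle × G, F (mk ω p.1 p.2) ∂(circleHaar.prod μ) = ∫ γ, upsilon 0 F γ ∂μ := by
  have hF : Continuous fun p : Circle × G => F (mk ω p.1 p.2) :=
    F.continuous.comp continuous_mk
  have hFc : HasCompactSupport fun p : Circle × G => F (mk ω p.1 p.2) :=
    F.hasCompactSupport
  have hI : Integrable (fun p : Circle × G => F (mk ω p.1 p.2)) (circleHaar.prod μ) :=
    hF.integrable_of_hasCompactSupport hFc
  rw [integral_prod_symm _ hI]
  exact integral_congr_ae (Eventually.of_forall fun γ => (upsilon_zero_apply F γ).symm)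

theorem support_prod_eq (μ : Measure G) [SFinite μ] :
    (circleHaar.prod μ).support = {p : Circle × G | p.2 ∈ μ.support} := by
  ext ⟨t, γ⟩
  simp only [Set.mem_ofPred_eq, Measure.mem_support_iff_forall]
  constructor
  · intro h U hU
    have := h (Set.univ ×ˢ U) (prod_mem_nhds univ_mem hU)
    rw [Measure.prod_prod] at this
    exact pos_iff_ne_zero.2 (right_ne_zero_of_mul this.ne')
  · intro h W hW
    obtain ⟨V, hV, U, hU, hVU⟩ := mem_nhds_prod_iff.1 hW
    refine lt_of_lt_of_le ?_ (measure_mono hVU)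
    rw [Measure.prod_prod]
    exact ENNReal.mul_pos (Measure.measure_pos_of_mem_nhds _ hV).ne' (h U hU).ne'

theorem integral_translate (μ : Measure G) [IsFiniteMeasureOnCompacts μ] (a : Ext ω)
    (hsrc : ∀ᵐ η ∂μ, src a.arr = rng η) (F : C_c(Ext ω, ℂ)) :
    ∫ p : Circle × G, F (a * mk ω p.1 p.2) ∂(circleHaar.prod μ) =
      ∫ η, upsilon 0 F (a.arr * η) ∂μ := by
  -- the integrand vanishes off `𝕋 × C` for a compact subset `C` of the fibre
  set L : Set G := arr '' tsupport F with hL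
  have hLc : IsCompact L := F.hasCompactSupport.isCompact.image continuous_arr
  set C : Set G := (fun γ => a.arr⁻¹ * γ) '' (L ∩ {γ | rng a.arr = rng γ}) with hC
  have hCc : IsCompact C := by
    refine (hLc.inter_right (isClosed_eq continuous_const
      continuous_rng)).image_of_continuousOn ?_
    exact TopologicalGroupoid.continuousOn_mul.comp (Continuous.prodMk_right _).continuousOn
      fun γ hγ => (src_inv a.arr).trans hγ.2
  have hCsub : ∀ η ∈ C, src a.arr = rng η := by
    rintro _ ⟨γ, hγ, rfl⟩
    rw [rng_mul ((src_inv a.arr).trans hγ.2), rng_inv]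
  have hcont : ContinuousOn (fun p : Circle × G => F (a * mk ω p.1 p.2))
      (Set.univ ×ˢ C) := by
    have h1 : Continuous fun p : Circle × G => (a, mk ω p.1 p.2) :=
      continuous_const.prodMk continuous_mk
    have h2 : Set.MapsTo (fun p : Circle × G => (a, mk ω p.1 p.2)) (Set.univ ×ˢ C)
        (composable (Ext ω)) := fun p hp =>
      (mem_composable (a, mk ω p.1 p.2)).2 (hCsub _ hp.2)
    have h3 : ContinuousOn (fun p : Circle × G => a * mk ω p.1 p.2) (Set.univ ×ˢ C) :=
      ContinuousOn.comp (g := fun q : Ext ω × Ext ω => q.1 * q.2)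
        (f := fun p : Circle × G => (a, mk ω p.1 p.2)) (t := composable (Ext ω))
        continuousOn_mul h1.continuousOn h2
    exact F.continuous.comp_continuousOn h3
  have hI : Integrable (fun p : Circle × G => F (a * mk ω p.1 p.2))
      (circleHaar.prod μ) := by
    refine (hcont.integrableOn_compact
      (isCompact_univ.prod hCc)).integrable_of_ae_notMem_eq_zero ?_
    have hsrc' : ∀ᵐ p : Circle × G ∂(circleHaar.prod μ), src a.arr = rng p.2 :=
      Measure.quasiMeasurePreserving_snd.ae hsrc
    filter_upwards [hsrc'] with p hp hpC
    by_contra hne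
    refine hpC ⟨Set.mem_univ _, a.arr * p.2, ⟨⟨_, subset_tsupport _ hne, rfl⟩, ?_⟩,
      inv_mul_cancel_left hp⟩
    exact (rng_mul hp).symm
  refine (integral_prod_symm _ hI).trans (integral_congr_ae (Eventually.of_forall fun η => ?_))
  refine Eq.trans ?_ (upsilon_zero_apply F (a.arr * η)).symm
  change ∫ t : Circle, F (mk ω (a.circ * t * ω a.arr η) (a.arr * η)) ∂circleHaar = _
  have : ∀ t : Circle, a.circ * t * ω a.arr η = (a.circ * ω a.arr η) * t :=
    fun t => mul_right_comm _ _ _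
  simp_rw [this]
  exact integral_mul_left_eq_self
    (fun t : Circle => F (mk ω t (a.arr * η))) (a.circ * ω a.arr η)

/-- The Haar system `{τ × λᵘ}` on `G^ω`, where `τ` is the normalized Haar measure on `𝕋`. -/
def haarSystem (lam : HaarSystem G) (ω : TwoCocycle G) : HaarSystem (Ext ω) where
  meas v := circleHaar.prod (lam.meas (unitProj v))
  finite_on_compacts v := by
    have := lam.finite_on_compacts (unitProj v)
    exact inferInstanceAs
      (IsFiniteMeasureOnCompacts (circleHaar.prod (lam.meas (unitProj v))))
  support_eq v := by
    have := lam.finite_on_compacts (unitProj v)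
    refine (support_prod_eq (lam.meas (unitProj v))).trans ?_
    rw [lam.support_eq]
    refine Set.ext fun a : Ext ω => ?_
    change rngU a.arr = unitProj v ↔ rngU a = v
    rw [← unitProj_rngU, unitProj_injective.eq_iff]
  continuous_integral F := by
    refine ((lam.continuous_integral (upsilon 0 F)).comp continuous_unitProj).congr fun v => ?_
    have := lam.finite_on_compacts (unitProj v)
    exact (integral_prod_eq _ F).symm
  left_invariant a F := by
    have i1 := lam.finite_on_compacts (unitProj (srcU a))
    have i2 := lam.finite_on_compacts (unitProj (rngU a))
    refine Eq.trans ?_ (integral_prod_eq _ F).symm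
    rw [unitProj_rngU, ← lam.left_invariant, ← unitProj_srcU]
    refine integral_translate _ a ?_ F
    filter_upwards [lam.ae_rngU (unitProj (srcU a))] with η hη
    rw [unitProj_srcU] at hη
    exact (congrArg Subtype.val hη).symm

end Haar

end Ext

end GroupoidCStar

end

set_option linter.unusedSectionVars false

/-! The theorem is Fourier analysis in the circle variable. The functions `t⁻ⁿ f(γ)` (`Ext.embed`)
are the homogeneous pieces of `C_c(G^ω)`, and `Υ_n` extracts the corresponding coefficient. The
circle part of `(s, η)⁻¹(t, γ)` is `s⁻¹ t ω(η, η⁻¹γ)⁻¹`, and its power of exponent `-n` contributes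
precisely the twist `ω^n`. Hence `Υ_n` and `embed` are `*`-homomorphisms between the untwisted
algebra of `G^ω` and the `ω^n`-twisted algebra of `G` (`Ext.upsilon_conv`, `Ext.conv_embed`).
Orthogonality of characters gives `Υ_m ∘ embed_n = δ_{mn}` and makes pieces of different degree
multiply to zero. These maps are continuous for the inductive limit topologies, so representations
pull back along them and they induce maps of `C*`-algebras (`CStar.map`). Since trigonometric
polynomials are dense in `C(𝕋)`, the pieces together span a dense subspace, and
`exists_starAlgEquiv_directSum` concludes: `*`-homomorphisms contract, so a finite orthogonal sum is
controlled by the largest norm of its components.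

The analytic input is `exists_norm_toLin_le`: `‖ρ(h)‖ ≤ C sup |h|`, with `C` depending only on a
compact set containing the support of `h`. It gives finiteness of the norm, and it turns uniform
approximation with supports in a fixed compact set into norm approximation. It is proved directly,
without disintegrating `ρ`. Let `k = h * g`, let `h₁` be a cutoff with `h₁ h = h`, and put `F(x, y)
= c h₁(x) k(y) - h(x) g(x⁻¹y)`. The integral over `x` of `F(x, ·)^* * F(x, ·)` is a limit of sums of
elements `f^* * f` (`exists_sum_star_mul_approx`), so every vector functional is nonnegative on it.
Expanding the square gives `0 ≤ c² ⟨k, a k⟩ - 2c ‖k‖² + ⟨g, b g⟩` in the representation, where `a`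
and `b` are bounded functions of the range. A good `c` bounds `ρ(h)` on vectors `ρ(g)ξ`, and `g =
h^*` with the `C*`-identity bounds `ρ(h)`.

Finiteness for the twisted algebras follows because `f = Υ_n(embed_n f)`. -/

namespace GroupoidCStar

/-! ### Extension of functions from closed sets, and fine partitions of unity. -/

section Topology

/-- A continuous function on a closed set that vanishes off a compact set agrees on the closed set
with a compactly supported continuous function. -/
theorem exists_compactlySupported_eqOn {X : Type*} [TopologicalSpace X] [LocallyCompactSpace X]
    [T2Space X] [NormalSpace X] {D K : Set X} (hD : IsClosed D) (hK : IsCompact K) {f : X → ℂ}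
    (hf : ContinuousOn f D) (h0 : ∀ x ∈ D, x ∉ K → f x = 0) :
    ∃ F : C_c(X, ℂ), Set.EqOn F f D := by
  obtain ⟨Θ, hΘ⟩ := ContinuousMap.exists_restrict_eq hD
    (⟨D.domRestrict f, continuousOn_iff_continuous_domRestrict.1 hf⟩ : C(D, ℂ))
  have hΘ' : ∀ p ∈ D, Θ p = f p := fun p hp => DFunLike.congr_fun hΘ ⟨p, hp⟩
  obtain ⟨χ, hχ1, -, hχc, -⟩ := exists_continuous_one_zero_of_isCompact hK isClosed_empty
    (Set.disjoint_empty _)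
  refine ⟨⟨⟨fun x => (χ x : ℂ) * Θ x, by fun_prop⟩, ?_⟩, fun x hx => ?_⟩
  · exact (hχc.comp_left (g := fun x : ℝ => (x : ℂ)) Complex.ofReal_zero).mul_right
  · change (χ x : ℂ) * Θ x = f x
    rw [hΘ' x hx]
    by_cases hxK : x ∈ K
    · have : χ x = 1 := hχ1 hxK
      simp [this]
    · simp [h0 x hx hxK]

/-- A compactly supported continuous function of two variables is uniformly approximated by
freezing its first variable along a fine partition of unity. -/
theorem exists_partition_approx {X Y : Type*} [TopologicalSpace X] [TopologicalSpace Y]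
    [LocallyCompactSpace X] [T2Space X] [NormalSpace X] [ParacompactSpace X]
    (F : C_c(X × Y, ℂ)) :
    ∃ L : Set X, IsCompact L ∧ ∀ ε > 0, ∃ (s : Finset X) (χ : s → C(X, ℝ)),
      (∀ i, HasCompactSupport (χ i)) ∧ (∀ i x, 0 ≤ χ i x) ∧ (∀ i, ∀ x ∉ L, χ i x = 0) ∧
      (∀ x, ∑ i, χ i x ≤ 1) ∧ (∀ x y, F (x, y) ≠ 0 → ∑ i, χ i x = 1) ∧
      ∀ i x, χ i x ≠ 0 → ∀ y, ‖F (x, y) - F (i, y)‖ ≤ ε := by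
  have hK1 : IsCompact (Prod.fst '' tsupport F) := F.hasCompactSupport.isCompact.image continuous_fst
  have hK2 : IsCompact (Prod.snd '' tsupport F) := F.hasCompactSupport.isCompact.image continuous_snd
  -- `V` is chosen before `ε`, so the partitions for all `ε` live in one compact set, as the
  -- inductive limit topology demands.
  obtain ⟨V, hVo, hKV, hVc⟩ := exists_isOpen_superset_and_isCompact_closure hK1
  refine ⟨closure V, hVc, fun ε hε => ?_⟩
  have hU : ∀ x₀ : X, ∃ U : Set X, IsOpen U ∧ x₀ ∈ U ∧
      ∀ x ∈ U, ∀ y, ‖F (x, y) - F (x₀, y)‖ ≤ ε := by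
    intro x₀
    -- Tube lemma: continuity is uniform along the compact projection of the support.
    have : ∀ᶠ x in 𝓝 x₀, ∀ y ∈ Prod.snd '' tsupport F, ‖F (x, y) - F (x₀, y)‖ < ε := by
      refine hK2.eventually_forall_of_forall_eventually fun y _ => ?_
      have hc : Continuous fun p : X × Y => ‖F (p.1, p.2) - F (x₀, p.2)‖ :=
        (F.continuous.sub (F.continuous.comp (continuous_const.prodMk continuous_snd))).norm
      refine hc.continuousAt.eventually (gt_mem_nhds ?_)
      simpa using hε
    obtain ⟨U, hU, hUo, hx⟩ := eventually_nhds_iff.1 this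
    refine ⟨U, hUo, hx, fun x hxU y => ?_⟩
    by_cases hy : y ∈ Prod.snd '' tsupport F
    · exact (hU x hxU y hy).le
    · have h0 : ∀ x, F (x, y) = 0 := fun x => by
        by_contra hne
        exact hy ⟨(x, y), subset_tsupport _ hne, rfl⟩
      simp [h0, hε.le]
  choose U hUo hxU hUε using hU
  obtain ⟨s, hs⟩ := hK1.elim_finite_subcover U hUo
    fun x _ => Set.mem_iUnion.2 ⟨x, hxU x⟩
  obtain ⟨f, hf⟩ := PartitionOfUnity.exists_isSubordinate hK1.isClosed
    (fun i : s => U i ∩ V) (fun i => (hUo i).inter hVo) (fun x hx => by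
      obtain ⟨i, hi, hxi⟩ := Set.mem_iUnion₂.1 (hs hx)
      exact Set.mem_iUnion.2 ⟨⟨i, hi⟩, hxi, hKV hx⟩)
  have hsub : ∀ i x, f i x ≠ 0 → x ∈ U i ∩ V := fun i x hx => hf i (subset_tsupport _ hx)
  refine ⟨s, fun i => f i, fun i => HasCompactSupport.intro hVc fun x hx => ?_,
    fun i x => f.nonneg i x, fun i x hx => ?_, fun x => ?_, fun x y hxy => ?_,
    fun i x hx y => hUε i x (hsub i x hx).1 y⟩
  · by_contra hne
    exact hx (subset_closure (hsub i x hne).2)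
  · by_contra hne
    exact hx (subset_closure (hsub i x hne).2)
  · simpa [finsum_eq_sum_of_fintype] using f.sum_le_one x
  · simpa [finsum_eq_sum_of_fintype] using f.sum_eq_one (x := x)
      ⟨(x, y), subset_tsupport _ hxy, rfl⟩

end Topology

/-! ### Inverse of a product in a groupoid. -/

section Algebra

variable {G : Type u} [ArrowGroupoid G]

theorem mul_inv_rev' {γ η : G} (h : src γ = rng η) : (γ * η)⁻¹ = η⁻¹ * γ⁻¹ := by
  have h1 : src (γ * η) = rng η⁻¹ := by rw [src_mul h, rng_inv]
  have h2 : rng (γ * η)⁻¹ = src (γ * η) := rng_inv _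
  have h3 : (γ * η) * (η⁻¹ * γ⁻¹) = rng γ := by
    rw [← mul_assoc' h1 (by rw [src_inv, rng_inv, h]), mul_inv_cancel_right h]; rfl
  have h4 := inv_mul_cancel_left (γ := γ * η) (η := η⁻¹ * γ⁻¹)
    (by rw [h1, rng_mul (by rw [src_inv, rng_inv, h])])
  rw [h3] at h4
  have h5 := mul_src_self (γ * η)⁻¹
  rw [src_inv, rng_mul h] at h5
  rw [← h4, h5]

end Algebra

/-! ### Integration along the range fibres. -/

section Measure

variable {E : Type u} [TopologicalSpace E] [ArrowGroupoid E] [MeasurableSpace E]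
  [TopologicalGroupoid E] [SecondCountableTopology E] [LocallyCompactSpace E] [T2Space E]
  [BorelSpace E]

theorem isClosed_fibre (u : unitSpace E) : IsClosed {x : E | rngU x = u} :=
  isClosed_eq continuous_rngU continuous_const

theorem continuousOn_inv_mul :
    ContinuousOn (fun p : E × E => p.1⁻¹ * p.2) {p | rng p.1 = rng p.2} := by
  have hinv : Continuous fun γ : E => γ⁻¹ := TopologicalGroupoid.continuous_inv
  exact TopologicalGroupoid.continuousOn_mul.comp
    ((hinv.comp continuous_fst).prodMk continuous_snd).continuousOn
    fun p hp => (src_inv p.1).trans hp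

theorem isClosed_rng_eq : IsClosed {p : E × E | rng p.1 = rng p.2} :=
  isClosed_eq (continuous_rng.comp continuous_fst) (continuous_rng.comp continuous_snd)

namespace HaarSystem

variable (β : HaarSystem E)

instance (u : unitSpace E) : IsFiniteMeasureOnCompacts (β.meas u) := β.finite_on_compacts u

theorem integral_congr_fibre {V : Type*} [NormedAddCommGroup V] [NormedSpace ℝ V]
    {u : unitSpace E} {f g : E → V} (h : ∀ x, rngU x = u → f x = g x) :
    ∫ x, f x ∂(β.meas u) = ∫ x, g x ∂(β.meas u) :=
  integral_congr_ae ((β.ae_rngU u).mono h)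

/-- Integrands involving `η⁻¹γ` are meaningful and continuous only on a range fibre. Since `β^u` is
carried by that closed fibre, a Tietze extension may replace them. -/
theorem integrable_of_continuousOn {u : unitSpace E} {f : E → ℂ} {K : Set E} (hK : IsCompact K)
    (hf : ContinuousOn f {x | rngU x = u}) (h0 : ∀ x, rngU x = u → x ∉ K → f x = 0) :
    Integrable f (β.meas u) := by
  obtain ⟨F, hF⟩ := exists_compactlySupported_eqOn (isClosed_fibre u) hK hf h0
  exact (F.continuous.integrable_of_hasCompactSupport F.hasCompactSupport).congr
    ((β.ae_rngU u).mono hF)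

theorem integrable_prod_of_continuousOn {u : unitSpace E} {f : E × E → ℂ} {K : Set (E × E)}
    (hK : IsCompact K) (hf : ContinuousOn f ({x | rngU x = u} ×ˢ {x | rngU x = u}))
    (h0 : ∀ x y, rngU x = u → rngU y = u → (x, y) ∉ K → f (x, y) = 0) :
    Integrable f ((β.meas u).prod (β.meas u)) := by
  obtain ⟨F, hF⟩ := exists_compactlySupported_eqOn ((isClosed_fibre u).prod (isClosed_fibre u)) hK
    hf (fun p hp => h0 p.1 p.2 hp.1 hp.2)
  have h1 : ∀ᵐ p ∂((β.meas u).prod (β.meas u)), rngU p.1 = u :=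
    Measure.quasiMeasurePreserving_fst.ae (β.ae_rngU u)
  have h2 : ∀ᵐ p ∂((β.meas u).prod (β.meas u)), rngU p.2 = u :=
    Measure.quasiMeasurePreserving_snd.ae (β.ae_rngU u)
  refine (F.continuous.integrable_of_hasCompactSupport F.hasCompactSupport).congr ?_
  filter_upwards [h1, h2] with p hp1 hp2 using hF ⟨hp1, hp2⟩

/-- Carries left invariance from `C_c(E)` to functions controlled on a single fibre, the only kind
that the changes of variable below produce. -/
theorem integral_left_translate {γ : E} {f : E → ℂ} {K : Set E} (hK : IsCompact K)
    (hf : ContinuousOn f {x | rngU x = rngU γ}) (h0 : ∀ x, rngU x = rngU γ → x ∉ K → f x = 0) :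
    ∫ x, f (γ * x) ∂(β.meas (srcU γ)) = ∫ x, f x ∂(β.meas (rngU γ)) := by
  obtain ⟨F, hF⟩ := exists_compactlySupported_eqOn (isClosed_fibre (rngU γ)) hK hf h0
  rw [← β.integral_congr_fibre hF, ← β.left_invariant]
  refine β.integral_congr_fibre fun x hx => (hF (Subtype.ext ?_)).symm
  exact rng_mul (congrArg Subtype.val hx).symm

theorem continuous_integral_real {k : E → ℝ} (hk : Continuous k) (hkc : HasCompactSupport k) :
    Continuous fun γ : E => ∫ x, k x ∂(β.meas (rngU γ)) := by
  let kc : C_c(E, ℂ) := ⟨⟨fun x => (k x : ℂ), by fun_prop⟩,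
    hkc.comp_left (g := fun x : ℝ => (x : ℂ)) Complex.ofReal_zero⟩
  have h := Complex.continuous_re.comp ((β.continuous_integral kc).comp continuous_rngU)
  refine h.congr fun γ => ?_
  change (∫ x, ((k x : ℝ) : ℂ) ∂(β.meas (rngU γ))).re = _
  rw [integral_complex_ofReal, Complex.ofReal_re]

/-- A Haar system is uniformly bounded on a compact set. -/
theorem exists_measure_le {K : Set E} (hK : IsCompact K) :
    ∃ B : ℝ, 0 < B ∧ ∀ u, (β.meas u).real K ≤ B := by
  obtain ⟨χ, hχ1, -, hχc, hχ01⟩ :=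
    exists_continuous_one_zero_of_isCompact hK isClosed_empty (Set.disjoint_empty K)
  have hcont := β.continuous_integral_real χ.continuous hχc
  obtain ⟨B, hB⟩ := (hχc.isCompact.image_of_continuousOn hcont.continuousOn).bddAbove
  refine ⟨max B 1, by positivity, fun u => ?_⟩
  have hint : Integrable (fun x => χ x) (β.meas u) :=
    χ.continuous.integrable_of_hasCompactSupport hχc
  have h1 : (β.meas u).real K ≤ ∫ x, χ x ∂(β.meas u) := by
    rw [← integral_indicator_one hK.measurableSet]
    refine integral_mono ?_ hint fun x => ?_
    · exact (integrable_indicator_iff hK.measurableSet).2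
        (integrableOn_const hK.measure_lt_top.ne)
    · by_cases hx : x ∈ K
      · have : χ x = 1 := hχ1 hx
        simp [hx, this]
      · simpa [hx] using (hχ01 x).1
  -- Only units in the compact set `r(supp χ)` carry mass of `χ`; there continuity of the integral
  -- gives `B`, elsewhere the integral is zero.
  by_cases hu : ∃ γ ∈ tsupport χ, rngU γ = u
  · obtain ⟨γ, hγ, rfl⟩ := hu
    exact (h1.trans (hB ⟨γ, hγ, rfl⟩)).trans (le_max_left _ _)
  · have : ∫ x, χ x ∂(β.meas u) = ∫ x, (0 : ℝ) ∂(β.meas u) :=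
      β.integral_congr_fibre fun x hx => by
        by_contra hne
        exact hu ⟨x, subset_tsupport _ hne, hx⟩
    rw [this, integral_zero] at h1
    exact h1.trans (by positivity)

theorem norm_integral_le_of_measure_le {V : Type*} [NormedAddCommGroup V] [NormedSpace ℝ V]
    {u : unitSpace E} {K : Set E} (hK : IsCompact K) {B C : ℝ} (hB : (β.meas u).real K ≤ B)
    {f : E → V} (hC : 0 ≤ C) (hf : ∀ x, rngU x = u → ‖f x‖ ≤ C)
    (h0 : ∀ x, rngU x = u → x ∉ K → f x = 0) :
    ‖∫ x, f x ∂(β.meas u)‖ ≤ C * B := by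
  classical
  have h1 : ∫ x, f x ∂(β.meas u) = ∫ x, (K ∩ {x | rngU x = u}).indicator f x ∂(β.meas u) :=
    β.integral_congr_fibre fun x hx => by
      by_cases hxK : x ∈ K
      · exact (Set.indicator_of_mem (s := K ∩ {x | rngU x = u}) ⟨hxK, hx⟩ f).symm
      · rw [h0 x hx hxK, Set.indicator_of_notMem fun h => hxK h.1]
  have hKc : IsCompact (K ∩ {x | rngU x = u}) := hK.inter_right (isClosed_fibre u)
  rw [h1, integral_indicator hKc.measurableSet]
  refine (norm_setIntegral_le_of_norm_le_const hKc.measure_lt_top fun x hx => hf x hx.2).trans ?_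
  gcongr
  exact (measureReal_mono Set.inter_subset_left hK.measure_lt_top.ne).trans hB

end HaarSystem

end Measure

/-! ### Integrals of squares as limits of finite sums of squares. -/

section Positivity

variable {E : Type u} [TopologicalSpace E] [ArrowGroupoid E] [MeasurableSpace E]
  [TopologicalGroupoid E] [SecondCountableTopology E] [LocallyCompactSpace E] [T2Space E]
  [BorelSpace E]

theorem one_cocycle_apply (γ η : E) : (1 : TwoCocycle E) γ η = 1 := rfl

theorem conv_apply (β : HaarSystem E) (σ : TwoCocycle E) (f g : C_c(E, ℂ)) (γ : E) :
    conv β σ f g γ = ∫ η, f η * g (η⁻¹ * γ) * (σ η (η⁻¹ * γ) : ℂ) ∂(β.meas (rngU γ)) := rfl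

theorem conv_one_apply (β : HaarSystem E) (f g : C_c(E, ℂ)) (γ : E) :
    conv β 1 f g γ = ∫ η, f η * g (η⁻¹ * γ) ∂(β.meas (rngU γ)) := by
  simp [conv_apply, one_cocycle_apply]

theorem invol_apply (σ : TwoCocycle E) (f : C_c(E, ℂ)) (γ : E) :
    invol σ f γ = (starRingEnd ℂ) (f γ⁻¹) * (starRingEnd ℂ) (σ γ γ⁻¹ : ℂ) := rfl

theorem invol_one_apply (f : C_c(E, ℂ)) (γ : E) :
    invol 1 f γ = (starRingEnd ℂ) (f γ⁻¹) := by
  simp [invol_apply, one_cocycle_apply]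

theorem continuousOn_inv_mul_right (γ : E) :
    ContinuousOn (fun η : E => η⁻¹ * γ) {η | rngU η = rngU γ} :=
  continuousOn_inv_mul.comp (continuous_id.prodMk continuous_const).continuousOn
    fun _ hη => congrArg Subtype.val hη

theorem continuousOn_inv_mul_left (γ : E) :
    ContinuousOn (fun η : E => γ⁻¹ * η) {η | rngU η = rngU γ} :=
  continuousOn_inv_mul.comp (continuous_const.prodMk continuous_id).continuousOn
    fun _ hη => (congrArg Subtype.val hη).symm

theorem rngU_inv (γ : E) : rngU γ⁻¹ = srcU γ := Subtype.ext (rng_inv γ)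

theorem rngU_inv_mul {η γ : E} (h : rngU η = rngU γ) : rngU (η⁻¹ * γ) = srcU η :=
  Subtype.ext ((rng_mul ((src_inv η).trans (congrArg Subtype.val h))).trans (rng_inv η))

theorem integrable_mul_inv_mul (β : HaarSystem E) (f g : C_c(E, ℂ)) (γ : E) :
    Integrable (fun η => f η * g (η⁻¹ * γ)) (β.meas (rngU γ)) :=
  β.integrable_of_continuousOn f.hasCompactSupport.isCompact
    (f.continuous.continuousOn.mul (g.continuous.comp_continuousOn (continuousOn_inv_mul_right γ)))
    fun x _ hx => by rw [image_eq_zero_of_notMem_tsupport hx, zero_mul]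

theorem tsupport_subset_of_isCompact {X V : Type*} [TopologicalSpace X] [T2Space X] [Zero V]
    {f : X → V} {K : Set X} (hK : IsCompact K) (h : ∀ x ∉ K, f x = 0) : tsupport f ⊆ K :=
  closure_minimal (fun x hx => by_contra fun hxK => hx (h x hxK)) hK.isClosed

theorem norm_sub_le_of_conj_mul {a b a' b' : ℂ} {M δ : ℝ} (hb : ‖b'‖ ≤ M) (ha : ‖a‖ ≤ M)
    (hab : ‖a - a'‖ ≤ δ) (hbb : ‖b - b'‖ ≤ δ) :
    ‖(starRingEnd ℂ) a * b - (starRingEnd ℂ) a' * b'‖ ≤ 2 * M * δ := by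
  have : (starRingEnd ℂ) a * b - (starRingEnd ℂ) a' * b' =
      (starRingEnd ℂ) a * (b - b') + (starRingEnd ℂ) (a - a') * b' := by
    rw [map_sub]; ring
  have hM : 0 ≤ M := (norm_nonneg _).trans ha
  have hδ : 0 ≤ δ := (norm_nonneg _).trans hab
  calc _ ≤ ‖a‖ * ‖b - b'‖ + ‖a - a'‖ * ‖b'‖ := by
        rw [this]
        refine (norm_add_le _ _).trans ?_
        rw [norm_mul, norm_mul, RCLike.norm_conj, RCLike.norm_conj]
    _ ≤ M * δ + δ * M := by gcongr
    _ = _ := by ring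

/-- The integral over `x` of `F(x, ·)^* * F(x, ·)` is a limit of finite sums of elements `g^* * g`,
with supports in a fixed compact set. -/
theorem exists_sum_star_mul_approx (β : HaarSystem E) (F : C_c(E × E, ℂ)) (T : C_c(E, ℂ))
    (hint : ∀ γ, Integrable (fun η => ∫ x, (starRingEnd ℂ) (F (x, η⁻¹)) * F (x, η⁻¹ * γ)
      ∂(β.meas (srcU η))) (β.meas (rngU γ)))
    (hT : ∀ γ, T γ = ∫ η, (∫ x, (starRingEnd ℂ) (F (x, η⁻¹)) * F (x, η⁻¹ * γ)
      ∂(β.meas (srcU η))) ∂(β.meas (rngU γ))) :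
    ∃ K : Set E, IsCompact K ∧ tsupport T ⊆ K ∧ ∀ ε > 0, ∃ (s : Finset E) (g : s → C_c(E, ℂ)),
      tsupport (∑ i, conv β 1 (invol 1 (g i)) (g i) : C_c(E, ℂ)) ⊆ K ∧
      ∀ γ, ‖T γ - (∑ i, conv β 1 (invol 1 (g i)) (g i) : C_c(E, ℂ)) γ‖ ≤ ε := by
  obtain ⟨L, hL, hχ⟩ := exists_partition_approx F
  set K2 : Set E := Prod.snd '' tsupport F with hK2
  have hK2c : IsCompact K2 := F.hasCompactSupport.isCompact.image continuous_snd
  set J : Set E := (fun x => x⁻¹) '' K2 with hJ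
  have hJc : IsCompact J := hK2c.image TopologicalGroupoid.continuous_inv
  have hF0 : ∀ x, ∀ y ∉ K2, F (x, y) = 0 := fun x y hy => by
    by_contra hne
    exact hy ⟨(x, y), subset_tsupport _ hne, rfl⟩
  have hFJ : ∀ x, ∀ y ∉ J, F (x, y⁻¹) = 0 := fun x y hy => hF0 x _ fun h =>
    hy ⟨y⁻¹, h, inv_inv y⟩
  -- `J * K2` contains the support of every `g^* * g` with `g` supported in `K2`, whatever the
  -- partition.
  set P : Set E := (fun p : E × E => p.1 * p.2) '' ((J ×ˢ K2) ∩ composable E) with hP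
  have hPc : IsCompact P := ((hJc.prod hK2c).inter_right
    isClosed_composable).image_of_continuousOn
    (TopologicalGroupoid.continuousOn_mul.mono Set.inter_subset_right)
  refine ⟨P ∪ tsupport T, hPc.union T.hasCompactSupport.isCompact, Set.subset_union_right,
    fun ε hε => ?_⟩
  obtain ⟨B₁, hB₁, hLB⟩ := β.exists_measure_le hL
  obtain ⟨B₂, hB₂, hJB⟩ := β.exists_measure_le hJc
  obtain ⟨M, hM0, hM⟩ : ∃ M : ℝ, 0 < M ∧ ∀ p, ‖F p‖ ≤ M :=
    ⟨‖F.toBoundedContinuousFunction‖ + 1, by positivity, fun p =>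
      (F.toBoundedContinuousFunction.norm_coe_le_norm p).trans (by linarith)⟩
  -- Freezing the first variable costs `2Mδ` pointwise; integrating over `L` and over `J` multiplies
  -- this by at most `B₁` and `B₂`.
  set δ : ℝ := ε / (2 * M * B₁ * B₂) with hδ
  have hδ0 : 0 < δ := by positivity
  obtain ⟨s, χ, hχc, hχ0, hχL, hχ1, hχF, hχε⟩ := hχ δ hδ0
  have hΛc : ∀ i, Continuous fun γ : E => ∫ x, χ i x ∂(β.meas (rngU γ)) := fun i =>
    β.continuous_integral_real (χ i).continuous (hχc i)
  have hΛ0 : ∀ i u, 0 ≤ ∫ x, χ i x ∂(β.meas u) := fun i u => integral_nonneg (hχ0 i)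
  -- In `g_i^* * g_i` the two factors are evaluated at `η⁻¹` and `η⁻¹γ`, both with range `s(η)`, so
  -- the two square roots multiply to the weight `∫ χ_i dβ^{s(η)}`.
  let g : s → C_c(E, ℂ) := fun i =>
    ⟨⟨fun γ => (Real.sqrt (∫ x, χ i x ∂(β.meas (rngU γ))) : ℂ) * F (i, γ),
      (Complex.continuous_ofReal.comp (Real.continuous_sqrt.comp (hΛc i))).mul
        (F.continuous.comp (Continuous.prodMk_right _))⟩,
      HasCompactSupport.intro hK2c fun x hx => (congrArg _ (hF0 _ x hx)).trans (mul_zero _)⟩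
  have hg : ∀ i γ, g i γ = (Real.sqrt (∫ x, χ i x ∂(β.meas (rngU γ))) : ℂ) * F (i, γ) :=
    fun i γ => rfl
  have hsum : ∀ γ, (∑ i, conv β 1 (invol 1 (g i)) (g i) : C_c(E, ℂ)) γ =
      ∑ i, conv β 1 (invol 1 (g i)) (g i) γ := fun γ => by
    simp [CompactlySupportedContinuousMap.coe_sum]
  refine ⟨s, g, (tsupport_subset_of_isCompact hPc fun γ hγ => ?_).trans Set.subset_union_left,
    fun γ => ?_⟩
  · rw [hsum]
    refine Finset.sum_eq_zero fun i _ => convFun_eq_zero β 1 _ _ fun h => hγ ?_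
    refine Set.image_mono (Set.inter_subset_inter_left _ (Set.prod_mono
      (tsupport_subset_of_isCompact hJc fun y hy => ?_)
      (tsupport_subset_of_isCompact hK2c fun y hy => ?_))) h
    · rw [invol_one_apply, hg, hFJ _ y hy, mul_zero, map_zero]
    · rw [hg, hF0 _ y hy, mul_zero]
  set A : E → E → ℂ := fun x η => (starRingEnd ℂ) (F (x, η⁻¹)) * F (x, η⁻¹ * γ) with hA
  have hS : (∑ i, conv β 1 (invol 1 (g i)) (g i) : C_c(E, ℂ)) γ =
      ∫ η, ∑ i, (invol 1 (g i)) η * g i (η⁻¹ * γ) ∂(β.meas (rngU γ)) := by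
    rw [hsum, integral_finsetSum _ fun i _ => integrable_mul_inv_mul β _ _ γ]
    simp only [conv_one_apply]
  have hin : ∀ η, Integrable (fun x => A x η) (β.meas (srcU η)) := fun η => by
    have h1 : Continuous fun x => A x η :=
      (Complex.continuous_conj.comp (F.continuous.comp (Continuous.prodMk_left _))).mul
        (F.continuous.comp (Continuous.prodMk_left _))
    refine β.integrable_of_continuousOn (F.hasCompactSupport.isCompact.image continuous_fst)
      h1.continuousOn fun x _ hx => ?_
    have : F (x, η⁻¹ * γ) = 0 := by
      by_contra hne
      exact hx ⟨_, subset_tsupport _ hne, rfl⟩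
    rw [hA]; simp only [this, mul_zero]
  have hχi : ∀ i u, Integrable (fun x => χ i x) (β.meas u) := fun i u =>
    (χ i).continuous.integrable_of_hasCompactSupport (hχc i)
  have hχAi : ∀ i η, Integrable (fun x => (χ i x : ℂ) * A i η) (β.meas (srcU η)) :=
    fun i η => (hχi i _).ofReal.mul_const _
  have hterm : ∀ η, rngU η = rngU γ → ∑ i, (invol 1 (g i)) η * g i (η⁻¹ * γ) =
      ∫ x, ∑ i, (χ i x : ℂ) * A i η ∂(β.meas (srcU η)) := by
    intro η hη
    rw [integral_finsetSum _ fun i _ => hχAi i η]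
    refine Finset.sum_congr rfl fun i _ => ?_
    rw [integral_mul_const, integral_complex_ofReal, invol_one_apply, hg, hg, rngU_inv,
      rngU_inv_mul hη, map_mul, Complex.conj_ofReal]
    have := Real.mul_self_sqrt (hΛ0 i (srcU η))
    conv_rhs => rw [← this]
    push_cast
    ring
  rw [hT, hS, ← integral_sub (hint γ)
    (integrable_finsetSum _ fun i _ => integrable_mul_inv_mul β _ _ γ)]
  -- Where `F(x, η⁻¹) ≠ 0` the partition sums to one; elsewhere `A x η` vanishes. So `A x η` may be
  -- spread over the partition and compared term by term.
  have hDx : ∀ η x, ‖A x η - ∑ i, (χ i x : ℂ) * A i η‖ ≤ 2 * M * δ := by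
    intro η x
    have h1 : A x η = ∑ i, (χ i x : ℂ) * A x η := by
      by_cases hx : F (x, η⁻¹) = 0
      · simp [hA, hx]
      · rw [← Finset.sum_mul, ← Complex.ofReal_sum, hχF x _ hx, Complex.ofReal_one, one_mul]
    rw [h1, ← Finset.sum_sub_distrib]
    refine (norm_sum_le _ _).trans ?_
    calc _ ≤ ∑ i, χ i x * (2 * M * δ) := by
          refine Finset.sum_le_sum fun i _ => ?_
          rw [← mul_sub, norm_mul, Complex.norm_real, Real.norm_of_nonneg (hχ0 i x)]
          by_cases hi : χ i x = 0
          · simp [hi]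
          · exact mul_le_mul_of_nonneg_left (norm_sub_le_of_conj_mul (hM _) (hM _)
              (hχε i x hi _) (hχε i x hi _)) (hχ0 i x)
      _ = (∑ i, χ i x) * (2 * M * δ) := by rw [Finset.sum_mul]
      _ ≤ 1 * (2 * M * δ) := by gcongr; exact hχ1 x
      _ = _ := one_mul _
  have hin' : ∀ η, ‖∫ x, (A x η - ∑ i, (χ i x : ℂ) * A i η) ∂(β.meas (srcU η))‖ ≤
      2 * M * δ * B₁ := fun η => by
    refine β.norm_integral_le_of_measure_le hL (hLB _) (by positivity) (fun x _ => hDx η x)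
      fun x _ hx => ?_
    have h1 : ∀ y, F (x, y) = 0 := fun y => by
      by_contra hne
      have := hχF x y hne
      simp [hχL _ x hx] at this
    simp [hA, h1, hχL _ x hx]
  have hfin : ‖∫ η, ((∫ x, A x η ∂(β.meas (srcU η))) -
      ∑ i, (invol 1 (g i)) η * g i (η⁻¹ * γ)) ∂(β.meas (rngU γ))‖ ≤ 2 * M * δ * B₁ * B₂ := by
    refine β.norm_integral_le_of_measure_le hJc (hJB _) (by positivity) (fun η hη => ?_)
      fun η hη hηJ => ?_
    · rw [hterm η hη, ← integral_sub (hin η) (integrable_finsetSum _ fun i _ => hχAi i η)]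
      exact hin' η
    · simp [hA, hFJ _ η hηJ, invol_one_apply, hg]
  refine hfin.trans_eq ?_
  rw [hδ]
  field_simp

end Positivity

/-! ### The expanded square and its double integral. -/

section Bound

variable {E : Type u} [TopologicalSpace E] [ArrowGroupoid E] [MeasurableSpace E]
  [TopologicalGroupoid E] [SecondCountableTopology E] [LocallyCompactSpace E] [T2Space E]
  [BorelSpace E]

/-- The product of a continuous real function and a compactly supported one. -/
noncomputable def realMul (a : C(E, ℝ)) (f : C_c(E, ℂ)) : C_c(E, ℂ) where
  toFun x := (a x : ℂ) * f x
  continuous_toFun := (Complex.continuous_ofReal.comp a.continuous).mul f.continuous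
  hasCompactSupport' := f.hasCompactSupport.mul_left

theorem realMul_apply (a : C(E, ℝ)) (f : C_c(E, ℂ)) (x : E) : realMul a f x = (a x : ℂ) * f x := rfl

/-- The function `x ↦ ∫ w dβ^{r(x)}`. -/
noncomputable def fibreIntegral (β : HaarSystem E) {w : E → ℝ} (hw : Continuous w)
    (hwc : HasCompactSupport w) : C(E, ℝ) where
  toFun x := ∫ z, w z ∂(β.meas (rngU x))
  continuous_toFun := β.continuous_integral_real hw hwc

theorem fibreIntegral_apply (β : HaarSystem E) {w : E → ℝ} (hw : Continuous w)
    (hwc : HasCompactSupport w) (x : E) :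
    fibreIntegral β hw hwc x = ∫ z, w z ∂(β.meas (rngU x)) := rfl

/-- Since `h₁ h = h` the cutoff disappears from the cross terms, where the integral over `x`
reproduces `k = h * g`. The identity needs `y` and `y'` to have the same range, so that one fibre
measure serves both convolutions. -/
theorem integral_conj_mul_expand (β : HaarSystem E) (h g : C_c(E, ℂ)) (h₁ : C(E, ℝ))
    (hc : HasCompactSupport h₁) (hh : ∀ x, (h₁ x : ℂ) * h x = h x) (c : ℝ)
    (Q : C_c(E × E, ℂ))
    (hQ : Set.EqOn Q (fun p => h p.1 * g (p.1⁻¹ * p.2)) {p | rng p.1 = rng p.2})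
    {y y' : E} (hy : rngU y' = rngU y) :
    (Integrable (fun x => (‖h x‖ ^ 2 : ℂ) * ((starRingEnd ℂ) (g (x⁻¹ * y)) * g (x⁻¹ * y')))
      (β.meas (rngU y))) ∧
    ∫ x, (starRingEnd ℂ) (c * h₁ x * conv β 1 h g y - Q (x, y)) *
        (c * h₁ x * conv β 1 h g y' - Q (x, y')) ∂(β.meas (rngU y)) =
      c ^ 2 * ((starRingEnd ℂ) (conv β 1 h g y) *
        (((∫ x, h₁ x ^ 2 ∂(β.meas (rngU y)) : ℝ) : ℂ) * conv β 1 h g y')) -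
      2 * c * ((starRingEnd ℂ) (conv β 1 h g y) * conv β 1 h g y') +
      ∫ x, (‖h x‖ ^ 2 : ℂ) * ((starRingEnd ℂ) (g (x⁻¹ * y)) * g (x⁻¹ * y'))
        ∂(β.meas (rngU y)) := by
  set k := conv β 1 h g with hk
  have I4 : Integrable (fun x => (‖h x‖ ^ 2 : ℂ) * ((starRingEnd ℂ) (g (x⁻¹ * y)) * g (x⁻¹ * y')))
      (β.meas (rngU y)) := by
    refine β.integrable_of_continuousOn h.hasCompactSupport.isCompact
      (ContinuousOn.mul ?_ (ContinuousOn.mul ?_ ?_)) fun x _ hx => ?_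
    · exact (by fun_prop : Continuous fun x => (‖h x‖ ^ 2 : ℂ)).continuousOn
    · exact (Complex.continuous_conj.comp g.continuous).comp_continuousOn
        (continuousOn_inv_mul_right y)
    · refine g.continuous.comp_continuousOn ?_
      rw [← hy]
      exact continuousOn_inv_mul_right y'
    · simp [image_eq_zero_of_notMem_tsupport hx]
  have I1 : Integrable (fun x => ((h₁ x ^ 2 : ℝ) : ℂ)) (β.meas (rngU y)) :=
    (Continuous.integrable_of_hasCompactSupport (f := fun x => h₁ x ^ 2) (by fun_prop)
      (hc.comp_left (g := fun t : ℝ => t ^ 2) (by simp))).ofReal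
  have I2 : Integrable (fun x => h x * g (x⁻¹ * y')) (β.meas (rngU y)) :=
    hy ▸ integrable_mul_inv_mul β h g y'
  have I3 : Integrable (fun x => (starRingEnd ℂ) (h x * g (x⁻¹ * y))) (β.meas (rngU y)) :=
    (Complex.conjCLE : ℂ →L[ℝ] ℂ).integrable_comp (integrable_mul_inv_mul β h g y)
  refine ⟨I4, ?_⟩
  have e2 : ∫ x, h x * g (x⁻¹ * y') ∂(β.meas (rngU y)) = k y' := by
    rw [hk, conv_one_apply, hy]
  have e3 : ∫ x, (starRingEnd ℂ) (h x * g (x⁻¹ * y)) ∂(β.meas (rngU y)) =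
      (starRingEnd ℂ) (k y) := by
    rw [integral_conj, hk, conv_one_apply]
  have e1 : ∫ x, ((h₁ x ^ 2 : ℝ) : ℂ) ∂(β.meas (rngU y)) =
      ((∫ x, h₁ x ^ 2 ∂(β.meas (rngU y)) : ℝ) : ℂ) := integral_complex_ofReal
  have hpt : ∀ x, rngU x = rngU y →
      (starRingEnd ℂ) (c * h₁ x * k y - Q (x, y)) * (c * h₁ x * k y' - Q (x, y')) =
      (c ^ 2 * ((starRingEnd ℂ) (k y) * k y')) * ((h₁ x ^ 2 : ℝ) : ℂ) -
        (c * (starRingEnd ℂ) (k y)) * (h x * g (x⁻¹ * y')) -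
        (c * k y') * (starRingEnd ℂ) (h x * g (x⁻¹ * y)) +
        (‖h x‖ ^ 2 : ℂ) * ((starRingEnd ℂ) (g (x⁻¹ * y)) * g (x⁻¹ * y')) := by
    intro x hx
    have q1 : Q (x, y) = h x * g (x⁻¹ * y) := hQ (congrArg Subtype.val hx)
    have q2 : Q (x, y') = h x * g (x⁻¹ * y') := hQ (congrArg Subtype.val (hx.trans hy.symm))
    have hh' : (h₁ x : ℂ) * (starRingEnd ℂ) (h x) = (starRingEnd ℂ) (h x) := by
      conv_rhs => rw [← hh x, map_mul, Complex.conj_ofReal]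
    rw [q1, q2, ← Complex.conj_mul']
    simp only [map_sub, map_mul, Complex.conj_ofReal]
    push_cast
    linear_combination (-c * (starRingEnd ℂ) (k y) * g (x⁻¹ * y')) * hh x -
      c * k y' * (starRingEnd ℂ) (g (x⁻¹ * y)) * hh'
  have J1 := I1.const_mul (c ^ 2 * ((starRingEnd ℂ) (k y) * k y'))
  have J2 := I2.const_mul (c * (starRingEnd ℂ) (k y))
  have J3 := I3.const_mul (c * k y')
  have J12 : Integrable (fun x => (c ^ 2 * ((starRingEnd ℂ) (k y) * k y')) * ((h₁ x ^ 2 : ℝ) : ℂ) -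
      (c * (starRingEnd ℂ) (k y)) * (h x * g (x⁻¹ * y'))) (β.meas (rngU y)) := J1.sub J2
  have J123 : Integrable (fun x => (c ^ 2 * ((starRingEnd ℂ) (k y) * k y')) *
      ((h₁ x ^ 2 : ℝ) : ℂ) - (c * (starRingEnd ℂ) (k y)) * (h x * g (x⁻¹ * y')) -
      (c * k y') * (starRingEnd ℂ) (h x * g (x⁻¹ * y))) (β.meas (rngU y)) := J12.sub J3
  rw [β.integral_congr_fibre hpt, integral_add J123 I4, integral_sub J12 J3,
    integral_sub J1 J2, integral_const_mul, integral_const_mul,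
    integral_const_mul, e1, e2, e3]
  ring

/-- The square function of the convolution by `h`, computed by left invariance. -/
theorem integral_integral_norm_sq (β : HaarSystem E) (h g : C_c(E, ℂ)) {w : E → ℝ}
    (hw : Continuous w) (hwc : HasCompactSupport w) (hwh : ∀ z, w z = ‖h z⁻¹‖ ^ 2) (γ : E) :
    Integrable (fun η => ∫ x, (‖h x‖ ^ 2 : ℂ) * ((starRingEnd ℂ) (g (x⁻¹ * η⁻¹)) *
      g (x⁻¹ * (η⁻¹ * γ))) ∂(β.meas (srcU η))) (β.meas (rngU γ)) ∧
    ∫ η, (∫ x, (‖h x‖ ^ 2 : ℂ) * ((starRingEnd ℂ) (g (x⁻¹ * η⁻¹)) *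
      g (x⁻¹ * (η⁻¹ * γ))) ∂(β.meas (srcU η))) ∂(β.meas (rngU γ)) =
    conv β 1 (invol 1 g) (realMul (fibreIntegral β hw hwc) g) γ := by
  have hinv : Continuous fun γ : E => γ⁻¹ := TopologicalGroupoid.continuous_inv
  -- The integrand after the substitution `κ = ηx`. Both variables now run over the fibre of `r(γ)`,
  -- so Fubini applies to a single product measure.
  set W : E → E → ℂ := fun η κ =>
    (‖h (η⁻¹ * κ)‖ ^ 2 : ℂ) * ((starRingEnd ℂ) (g κ⁻¹) * g (κ⁻¹ * γ)) with hW
  set J : Set E := (fun x => x⁻¹) '' tsupport g with hJ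
  have hJc : IsCompact J := g.hasCompactSupport.isCompact.image hinv
  have hgJ : ∀ κ ∉ J, g κ⁻¹ = 0 := fun κ hκ => by
    by_contra hne
    exact hκ ⟨κ⁻¹, subset_tsupport _ hne, inv_inv κ⟩
  set J' : Set E := (fun x => x⁻¹) '' tsupport h with hJ'
  have hJ'c : IsCompact J' := h.hasCompactSupport.isCompact.image hinv
  set P : Set E := (fun p : E × E => p.1 * p.2) '' ((J ×ˢ J') ∩ composable E) with hP
  have hPc : IsCompact P := ((hJc.prod hJ'c).inter_right
    isClosed_composable).image_of_continuousOn
    (TopologicalGroupoid.continuousOn_mul.mono Set.inter_subset_right)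
  have hgg : ContinuousOn (fun κ => (starRingEnd ℂ) (g κ⁻¹) * g (κ⁻¹ * γ))
      {κ | rngU κ = rngU γ} :=
    (Complex.continuous_conj.comp (g.continuous.comp hinv)).continuousOn.mul
      (g.continuous.comp_continuousOn (continuousOn_inv_mul_right γ))
  have hn : Continuous fun x => (‖h x‖ ^ 2 : ℂ) := by fun_prop
  have hWη : ∀ η, rngU η = rngU γ → ContinuousOn (W η) {κ | rngU κ = rngU η} := by
    intro η hη
    refine ContinuousOn.mul (hn.comp_continuousOn (continuousOn_inv_mul_left η)) ?_
    rw [hη]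
    exact hgg
  have hWint : Integrable (Function.uncurry W) ((β.meas (rngU γ)).prod (β.meas (rngU γ))) := by
    refine β.integrable_prod_of_continuousOn (hPc.prod hJc) (ContinuousOn.mul ?_ ?_) ?_
    · refine hn.comp_continuousOn (continuousOn_inv_mul.mono ?_)
      rintro ⟨x, y⟩ ⟨hx, hy⟩
      exact congrArg Subtype.val (Eq.trans hx (Eq.symm hy))
    · exact hgg.comp continuous_snd.continuousOn fun p hp => hp.2
    · intro η κ hη hκ hne
      by_contra h0
      change W η κ ≠ 0 at h0
      have hr : rng η = rng κ := congrArg Subtype.val (hη.trans hκ.symm)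
      have h1 : κ ∈ J := by
        by_contra hκJ
        exact h0 (by simp [hW, hgJ κ hκJ])
      have h2 : η⁻¹ * κ ∈ tsupport h := by
        by_contra hx
        exact h0 (by simp [hW, image_eq_zero_of_notMem_tsupport hx])
      refine hne ⟨⟨(κ, (η⁻¹ * κ)⁻¹), ⟨⟨h1, _, h2, rfl⟩, ?_⟩, ?_⟩, h1⟩
      · change src κ = rng (η⁻¹ * κ)⁻¹
        rw [rng_inv, src_mul ((src_inv η).trans hr)]
      · change κ * (η⁻¹ * κ)⁻¹ = η
        rw [mul_inv_rev' ((src_inv η).trans hr), inv_inv, mul_inv_cancel_left hr.symm]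
  have hinner : ∀ η, rngU η = rngU γ →
      ∫ x, (‖h x‖ ^ 2 : ℂ) * ((starRingEnd ℂ) (g (x⁻¹ * η⁻¹)) * g (x⁻¹ * (η⁻¹ * γ)))
        ∂(β.meas (srcU η)) = ∫ κ, W η κ ∂(β.meas (rngU γ)) := by
    intro η hη
    rw [← hη, ← β.integral_left_translate hJc (hWη η hη) fun κ _ hκ => by simp [hW, hgJ κ hκ]]
    refine β.integral_congr_fibre fun x hx => ?_
    have hx' : src η = rng x := (congrArg Subtype.val hx).symm
    have hη' : rng η = rng γ := congrArg Subtype.val hη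
    simp only [hW]
    rw [inv_mul_cancel_left hx', mul_inv_rev' hx', mul_assoc' (by rw [src_inv, rng_inv, hx'])
      (by rw [src_inv, hη'])]
  -- For fixed `κ` only `‖h(η⁻¹κ)‖²` depends on `η`; the substitution `η = κz` turns `η⁻¹κ` into
  -- `z⁻¹`, whence the weight `w`.
  have houter : ∀ κ, rngU κ = rngU γ → ∫ η, W η κ ∂(β.meas (rngU γ)) =
      invol 1 g κ * realMul (fibreIntegral β hw hwc) g (κ⁻¹ * γ) := by
    intro κ hκ
    rw [integral_mul_const, invol_one_apply, realMul_apply, fibreIntegral_apply,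
      rngU_inv_mul hκ]
    have : ∫ η, (‖h (η⁻¹ * κ)‖ ^ 2 : ℂ) ∂(β.meas (rngU γ)) =
        ((∫ z, w z ∂(β.meas (srcU κ)) : ℝ) : ℂ) := by
      have hcont : ContinuousOn (fun η => (‖h (η⁻¹ * κ)‖ ^ 2 : ℂ)) {η | rngU η = rngU κ} :=
        hn.comp_continuousOn (continuousOn_inv_mul_right κ)
      obtain ⟨KK, hKKc, hKK⟩ : ∃ K : Set E, IsCompact K ∧
          ∀ η, rngU η = rngU κ → η ∉ K → (‖h (η⁻¹ * κ)‖ ^ 2 : ℂ) = 0 := by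
        refine ⟨_, (((isCompact_singleton (x := κ)).prod hJ'c).inter_right
          isClosed_composable).image_of_continuousOn
          (TopologicalGroupoid.continuousOn_mul.mono Set.inter_subset_right), fun η hη hne => ?_⟩
        have hr : rng η = rng κ := congrArg Subtype.val hη
        by_contra h0
        have h2 : η⁻¹ * κ ∈ tsupport h := by
          by_contra hx
          exact h0 (by simp [image_eq_zero_of_notMem_tsupport hx])
        refine hne ⟨(κ, (η⁻¹ * κ)⁻¹), ⟨⟨rfl, _, h2, rfl⟩, ?_⟩, ?_⟩
        · change src κ = rng (η⁻¹ * κ)⁻¹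
          rw [rng_inv, src_mul ((src_inv η).trans hr)]
        · change κ * (η⁻¹ * κ)⁻¹ = η
          rw [mul_inv_rev' ((src_inv η).trans hr), inv_inv, mul_inv_cancel_left hr.symm]
      rw [← hκ, ← β.integral_left_translate hKKc hcont hKK, ← integral_complex_ofReal]
      refine β.integral_congr_fibre fun z hz => ?_
      have hz' : src κ = rng z := (congrArg Subtype.val hz).symm
      have : (κ * z)⁻¹ * κ = z⁻¹ := by
        rw [mul_inv_rev' hz', mul_assoc' (by rw [src_inv, rng_inv, hz']) (src_inv κ)]
        change z⁻¹ * src κ = z⁻¹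
        rw [hz', ← src_inv, mul_src_self]
      rw [this, hwh]
      push_cast
      rfl
    rw [this]
    ring
  constructor
  · exact hWint.integral_prod_left.congr ((β.ae_rngU _).mono fun η hη => (hinner η hη).symm)
  · rw [β.integral_congr_fibre hinner, integral_integral_swap hWint,
      β.integral_congr_fibre houter, conv_one_apply]

end Bound

/-! ### Uniform boundedness of representations of the untwisted algebra. -/

section Bound

variable {E : Type u} [TopologicalSpace E] [ArrowGroupoid E] [MeasurableSpace E]
  [TopologicalGroupoid E] [SecondCountableTopology E] [LocallyCompactSpace E] [T2Space E]
  [BorelSpace E]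

/-- A vector functional of a representation is nonnegative at a limit, uniform with supports in a
fixed compact set, of functions at which it is nonnegative. -/
theorem Rep.re_inner_nonneg_of_approx {β : HaarSystem E} {σ : TwoCocycle E} (ρ : Rep β σ)
    (ξ : ρ.H) {K : Set E} (hK : IsCompact K) {T : C_c(E, ℂ)} (hT : tsupport T ⊆ K)
    (h : ∀ ε > 0, ∃ P : C_c(E, ℂ), tsupport P ⊆ K ∧ (∀ γ, ‖T γ - P γ‖ ≤ ε) ∧
      0 ≤ (inner ℂ ξ (ρ.toLin P ξ)).re) :
    0 ≤ (inner ℂ ξ (ρ.toLin T ξ)).re := by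
  let tK : TopologicalSpace {f : C_c(E, ℂ) // tsupport f ⊆ K} :=
    TopologicalSpace.induced (fun f => f.1.toBoundedContinuousFunction) inferInstance
  have hval : @Continuous {f : C_c(E, ℂ) // tsupport f ⊆ K} C_c(E, ℂ) tK
      (inductiveLimitTopology E) Subtype.val :=
    continuous_sInf_rng.2 fun t ht => ht.2.2.2 K hK
  have hcont : Continuous fun f : {f : C_c(E, ℂ) // tsupport f ⊆ K} =>
      (inner ℂ ξ (ρ.toLin f.1 ξ)).re :=
    Complex.continuous_re.comp (ContinuousLinearMapWOT.continuous_inner_apply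
      (@Continuous.comp _ _ _ _ (inductiveLimitTopology E) _ _ _ ρ.continuous_wot hval) ξ ξ)
  have hcl : IsClosed {f : {f : C_c(E, ℂ) // tsupport f ⊆ K} |
      0 ≤ (inner ℂ ξ (ρ.toLin f.1 ξ)).re} := isClosed_le continuous_const hcont
  -- In `C_K(E)`, whose inclusion into `C_c(E)` is continuous, closure is uniform closure.
  have hmem : (⟨T, hT⟩ : {f : C_c(E, ℂ) // tsupport f ⊆ K}) ∈
      closure {f | 0 ≤ (inner ℂ ξ (ρ.toLin f.1 ξ)).re} := by
    have hind : IsInducing (fun f : {f : C_c(E, ℂ) // tsupport f ⊆ K} =>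
        f.1.toBoundedContinuousFunction) := ⟨rfl⟩
    rw [hind.closure_eq_preimage_closure_image, Set.mem_preimage, Metric.mem_closure_iff]
    intro ε hε
    obtain ⟨P, hPK, hPT, hP0⟩ := h (ε / 2) (by positivity)
    refine ⟨_, ⟨⟨P, hPK⟩, hP0, rfl⟩, ?_⟩
    refine lt_of_le_of_lt ((BoundedContinuousFunction.dist_le (by positivity)).2 fun γ => ?_)
      (half_lt_self hε)
    rw [dist_eq_norm]
    exact hPT γ
  rw [hcl.closure_eq] at hmem
  exact hmem

theorem Rep.inner_star_mul {β : HaarSystem E} {σ : TwoCocycle E} (ρ : Rep β σ)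
    (ξ : ρ.H) (f g : C_c(E, ℂ)) :
    inner ℂ ξ (ρ.toLin (conv β σ (invol σ f) g) ξ) = inner ℂ (ρ.toLin f ξ) (ρ.toLin g ξ) := by
  rw [ρ.map_conv, ρ.map_invol]
  change inner ℂ ξ ((star (ρ.toLin f)) (ρ.toLin g ξ)) = _
  rw [ContinuousLinearMap.star_eq_adjoint, ContinuousLinearMap.adjoint_inner_right]

theorem Rep.re_inner_self {β : HaarSystem E} {σ : TwoCocycle E} (ρ : Rep β σ)
    (ξ : ρ.H) (f : C_c(E, ℂ)) :
    (inner ℂ (ρ.toLin f ξ) (ρ.toLin f ξ)).re = ‖ρ.toLin f ξ‖ ^ 2 :=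
  inner_self_eq_norm_sq (𝕜 := ℂ) (ρ.toLin f ξ)

/-- Multiplication by a bounded nonnegative function of the range is bounded in every
representation. -/
theorem Rep.re_inner_realMul_le {β : HaarSystem E} (ρ : Rep β 1) (ξ : ρ.H) (f : C_c(E, ℂ))
    (a : C(E, ℝ)) (ha : ∀ x y, rngU x = rngU y → a x = a y) {B : ℝ} (hB : ∀ x, a x ≤ B) :
    (inner ℂ (ρ.toLin f ξ) (ρ.toLin (realMul a f) ξ)).re ≤ B * ‖ρ.toLin f ξ‖ ^ 2 := by
  -- With `b² = B - a` and both functions depending only on the range, `(bf)^* * (bf) = f^* * (Bf -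
  -- af)`, so the difference of the two sides is `‖ρ(bf)ξ‖²`.
  let b : C(E, ℝ) := ⟨fun x => Real.sqrt (B - a x), by fun_prop⟩
  have hb : ∀ x, b x * b x = B - a x := fun x => Real.mul_self_sqrt (sub_nonneg.2 (hB x))
  have key : conv β 1 (invol 1 (realMul b f)) (realMul b f) =
      conv β 1 (invol 1 f) ((B : ℂ) • f - realMul a f) := by
    ext γ
    rw [conv_one_apply, conv_one_apply]
    refine β.integral_congr_fibre fun η hη => ?_
    have hr : rngU η⁻¹ = rngU (η⁻¹ * γ) := by rw [rngU_inv_mul hη, rngU_inv]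
    have hbr : b η⁻¹ = b (η⁻¹ * γ) := congrArg (fun t => Real.sqrt (B - t)) (ha _ _ hr)
    have hb' : (b (η⁻¹ * γ) : ℂ) * b (η⁻¹ * γ) = B - a (η⁻¹ * γ) := by
      exact_mod_cast hb (η⁻¹ * γ)
    rw [invol_one_apply, invol_one_apply, realMul_apply, realMul_apply,
      CompactlySupportedContinuousMap.sub_apply, CompactlySupportedContinuousMap.smul_apply,
      realMul_apply, map_mul, Complex.conj_ofReal, hbr, smul_eq_mul]
    linear_combination (starRingEnd ℂ) (f η⁻¹) * f (η⁻¹ * γ) * hb'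
  have h1 := congrArg (fun F => (inner ℂ ξ (ρ.toLin F ξ)).re) key
  simp only [ρ.inner_star_mul] at h1
  rw [ρ.re_inner_self, map_sub, map_smul, sub_apply, inner_sub_right,
    smul_apply, inner_smul_right, Complex.sub_re, Complex.re_ofReal_mul,
    ρ.re_inner_self] at h1
  nlinarith [sq_nonneg ‖ρ.toLin (realMul b f) ξ‖]

/-- The expression is `⟨ξ, ρ(T)ξ⟩`, where `T` integrates `F(x, ·)^* * F(x, ·)` over `x` for `F(x, y)
= c h₁(x) k(y) - h(x) g(x⁻¹y)`. It is nonnegative because `T` is a limit of sums of squares. -/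
theorem Rep.re_inner_combination_nonneg {β : HaarSystem E} (ρ : Rep β 1) (ξ : ρ.H)
    (h g : C_c(E, ℂ)) (h₁ : C(E, ℝ)) (hc : HasCompactSupport h₁)
    (hh : ∀ x, (h₁ x : ℂ) * h x = h x) (c : ℝ) {w₁ w : E → ℝ} (hw₁ : Continuous w₁)
    (hw₁c : HasCompactSupport w₁) (hwh₁ : ∀ z, w₁ z = h₁ z ^ 2) (hw : Continuous w)
    (hwc : HasCompactSupport w) (hwh : ∀ z, w z = ‖h z⁻¹‖ ^ 2) :
    0 ≤ c ^ 2 * (inner ℂ (ρ.toLin (conv β 1 h g) ξ)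
        (ρ.toLin (realMul (fibreIntegral β hw₁ hw₁c) (conv β 1 h g)) ξ)).re -
      2 * c * ‖ρ.toLin (conv β 1 h g) ξ‖ ^ 2 +
      (inner ℂ (ρ.toLin g ξ) (ρ.toLin (realMul (fibreIntegral β hw hwc) g) ξ)).re := by
  set k := conv β 1 h g with hk
  -- `h(x) g(x⁻¹y)` makes sense only for `r(x) = r(y)`; `Q` extends it to `E × E`, and the integrals
  -- never see the values off that set.
  obtain ⟨Q, hQ⟩ := exists_compactlySupported_eqOn (f := fun p : E × E => h p.1 * g (p.1⁻¹ * p.2))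
    isClosed_rng_eq (h.hasCompactSupport.isCompact.prod (isCompact_suppMul h g))
    ((h.continuous.comp continuous_fst).continuousOn.mul
      (g.continuous.comp_continuousOn continuousOn_inv_mul))
    (fun p hp hpK => by
      by_contra hne
      have := mem_suppMul h g (γ := p.2) (η := p.1) hp hne
      exact hpK ⟨this.2, this.1⟩)
  let F : C_c(E × E, ℂ) :=
    ⟨⟨fun p => (c : ℂ) * h₁ p.1 * k p.2 - Q p,
      ((continuous_const.mul (Complex.continuous_ofReal.comp (h₁.continuous.comp
        continuous_fst))).mul (k.continuous.comp continuous_snd)).sub Q.continuous⟩, by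
      refine HasCompactSupport.intro ((hc.isCompact.prod k.hasCompactSupport.isCompact).union
        Q.hasCompactSupport.isCompact) fun p hp => ?_
      have hQp : Q p = 0 := image_eq_zero_of_notMem_tsupport fun h => hp (Or.inr h)
      change (c : ℂ) * h₁ p.1 * k p.2 - Q p = 0
      by_cases h1 : p.1 ∈ tsupport h₁
      · have : k p.2 = 0 := image_eq_zero_of_notMem_tsupport fun h => hp (Or.inl ⟨h1, h⟩)
        rw [hQp, this]; ring
      · rw [hQp, image_eq_zero_of_notMem_tsupport h1]; simp⟩
  have hF : ∀ x y, F (x, y) = c * h₁ x * k y - Q (x, y) := fun _ _ => rfl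
  set a := fibreIntegral β hw₁ hw₁c with ha
  set b := fibreIntegral β hw hwc with hb
  have hw₁' : w₁ = fun z => h₁ z ^ 2 := funext hwh₁
  have hav : ∀ y, ∫ x, h₁ x ^ 2 ∂(β.meas (rngU y)) = a y := fun y => by
    rw [ha, fibreIntegral_apply, hw₁']
  let T : C_c(E, ℂ) := (c ^ 2 : ℂ) • conv β 1 (invol 1 k) (realMul a k) -
    (2 * c : ℂ) • conv β 1 (invol 1 k) k + conv β 1 (invol 1 g) (realMul b g)
  have hTapp : ∀ γ, T γ = c ^ 2 * conv β 1 (invol 1 k) (realMul a k) γ -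
      2 * c * conv β 1 (invol 1 k) k γ + conv β 1 (invol 1 g) (realMul b g) γ := fun _ => rfl
  set S : E → E → ℂ := fun γ η => ∫ x, (‖h x‖ ^ 2 : ℂ) * ((starRingEnd ℂ) (g (x⁻¹ * η⁻¹)) *
      g (x⁻¹ * (η⁻¹ * γ))) ∂(β.meas (srcU η)) with hS
  have hpt : ∀ γ η, rngU η = rngU γ →
      ∫ x, (starRingEnd ℂ) (F (x, η⁻¹)) * F (x, η⁻¹ * γ) ∂(β.meas (srcU η)) =
        c ^ 2 * (invol 1 k η * realMul a k (η⁻¹ * γ)) - 2 * c * (invol 1 k η * k (η⁻¹ * γ)) +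
          S γ η := by
    intro γ η hη
    have hr : rngU (η⁻¹ * γ) = rngU η⁻¹ := by rw [rngU_inv_mul hη, rngU_inv]
    have := (integral_conj_mul_expand β h g h₁ hc hh c Q hQ hr).2
    have har : a η⁻¹ = a (η⁻¹ * γ) := by rw [← hav, ← hav, hr]
    simp only [hF]
    rw [hav, har, rngU_inv, ← hk] at this
    rw [this, invol_one_apply, realMul_apply]
  have hI1 : ∀ γ, Integrable (fun η => (c ^ 2 : ℂ) * (invol 1 k η * realMul a k (η⁻¹ * γ)))
      (β.meas (rngU γ)) := fun γ => (integrable_mul_inv_mul β _ _ γ).const_mul _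
  have hI2 : ∀ γ, Integrable (fun η => (2 * c : ℂ) * (invol 1 k η * k (η⁻¹ * γ)))
      (β.meas (rngU γ)) := fun γ => (integrable_mul_inv_mul β _ _ γ).const_mul _
  have hI12 : ∀ γ, Integrable (fun η => (c ^ 2 : ℂ) * (invol 1 k η * realMul a k (η⁻¹ * γ)) -
      (2 * c : ℂ) * (invol 1 k η * k (η⁻¹ * γ))) (β.meas (rngU γ)) :=
    fun γ => (hI1 γ).sub (hI2 γ)
  have hI3 : ∀ γ, Integrable (S γ) (β.meas (rngU γ)) ∧ ∫ η, S γ η ∂(β.meas (rngU γ)) =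
      conv β 1 (invol 1 g) (realMul b g) γ := fun γ =>
    integral_integral_norm_sq β h g hw hwc hwh γ
  obtain ⟨K, hK, hTK, happ⟩ := exists_sum_star_mul_approx β F T
    (fun γ => ((hI12 γ).add (hI3 γ).1).congr ((β.ae_rngU _).mono fun η hη => (hpt γ η hη).symm))
    (fun γ => by
      rw [β.integral_congr_fibre (hpt γ), integral_add (hI12 γ) (hI3 γ).1,
        integral_sub (hI1 γ) (hI2 γ), integral_const_mul, integral_const_mul, (hI3 γ).2,
        ← conv_one_apply, ← conv_one_apply, hTapp])
  have hpos := ρ.re_inner_nonneg_of_approx ξ hK hTK fun ε hε => by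
    obtain ⟨s, g', h1, h2⟩ := happ ε hε
    refine ⟨_, h1, h2, ?_⟩
    rw [map_sum, sum_apply, inner_sum, Complex.re_sum]
    refine Finset.sum_nonneg fun i _ => ?_
    rw [ρ.inner_star_mul, ρ.re_inner_self]
    positivity
  have hTe : (inner ℂ ξ (ρ.toLin T ξ)).re = c ^ 2 * (inner ℂ (ρ.toLin k ξ)
      (ρ.toLin (realMul a k) ξ)).re - 2 * c * ‖ρ.toLin k ξ‖ ^ 2 +
      (inner ℂ (ρ.toLin g ξ) (ρ.toLin (realMul b g) ξ)).re := by
    simp only [T, map_add, map_sub, map_smul, add_apply,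
      sub_apply, smul_apply, inner_add_right,
      inner_sub_right, inner_smul_right, ρ.inner_star_mul, Complex.add_re, Complex.sub_re]
    rw [← ρ.re_inner_self, ← Complex.ofReal_pow, Complex.re_ofReal_mul,
      show (2 * c : ℂ) = ((2 * c : ℝ) : ℂ) by push_cast; rfl, Complex.re_ofReal_mul]
  rwa [hTe] at hpos

/-- The representations of `C_c(E)` are bounded, uniformly over all representations, in terms of
the uniform norm of functions with support in a fixed compact set. -/
theorem exists_norm_toLin_le (β : HaarSystem E) {K : Set E} (hK : IsCompact K) :
    ∃ C : ℝ, 0 ≤ C ∧ ∀ (ρ : Rep β 1) (h : C_c(E, ℂ)), tsupport h ⊆ K → ∀ M : ℝ,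
      0 ≤ M → (∀ x, ‖h x‖ ≤ M) → ‖ρ.toLin h‖ ≤ C * M := by
  have hinv : Continuous fun γ : E => γ⁻¹ := TopologicalGroupoid.continuous_inv
  obtain ⟨χ, hχ1, -, hχc, hχ01⟩ :=
    exists_continuous_one_zero_of_isCompact hK isClosed_empty (Set.disjoint_empty K)
  obtain ⟨B₁, hB₁, hχB⟩ := β.exists_measure_le hχc.isCompact
  have hJ : IsCompact ((fun x : E => x⁻¹) '' K) := hK.image hinv
  obtain ⟨B₂, hB₂, hKB⟩ := β.exists_measure_le hJ
  -- `B₁` bounds the fibre measures of the support of the cutoff, `B₂` those of `K⁻¹`, where `z ↦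
  -- h(z⁻¹)` lives.
  refine ⟨Real.sqrt (B₁ * B₂), Real.sqrt_nonneg _, fun ρ h hhK M hM0 hM => ?_⟩
  have hh : ∀ x, (χ x : ℂ) * h x = h x := fun x => by
    by_cases hx : x ∈ K
    · have : χ x = 1 := hχ1 hx
      simp [this]
    · simp [image_eq_zero_of_notMem_tsupport fun h' => hx (hhK h')]
  have hw₁ : Continuous fun z => χ z ^ 2 := by fun_prop
  have hw₁c : HasCompactSupport fun z => χ z ^ 2 :=
    hχc.comp_left (g := fun t : ℝ => t ^ 2) (by simp)
  have hw : Continuous fun z => ‖h z⁻¹‖ ^ 2 := (h.continuous.comp hinv).norm.pow 2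
  have hw0 : ∀ z ∉ (fun x : E => x⁻¹) '' K, ‖h z⁻¹‖ ^ 2 = 0 := fun z hz => by
    rw [image_eq_zero_of_notMem_tsupport fun h' => hz ⟨z⁻¹, hhK h', inv_inv z⟩]
    simp
  have hwc : HasCompactSupport fun z => ‖h z⁻¹‖ ^ 2 := HasCompactSupport.intro hJ hw0
  have hle : ∀ (g : C_c(E, ℂ)) (ξ : ρ.H),
      ‖ρ.toLin h (ρ.toLin g ξ)‖ ≤ Real.sqrt (B₁ * B₂) * M * ‖ρ.toLin g ξ‖ := by
    intro g ξ
    -- `c = B₁⁻¹` minimizes `c² B₁ - 2c`; the minimum `-B₁⁻¹` yields `‖ρ(h)ρ(g)ξ‖² ≤ B₁ B₂ M²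
    -- ‖ρ(g)ξ‖²`.
    have h0 := ρ.re_inner_combination_nonneg ξ h g χ hχc hh B₁⁻¹ hw₁ hw₁c (fun _ => rfl) hw hwc
      (fun _ => rfl)
    have h1 := ρ.re_inner_realMul_le ξ (conv β 1 h g) (fibreIntegral β hw₁ hw₁c)
      (fun x y hxy => by rw [fibreIntegral_apply, fibreIntegral_apply, hxy]) (B := B₁)
      fun x => by
        refine (Real.le_norm_self _).trans ((β.norm_integral_le_of_measure_le hχc.isCompact
          (hχB _) zero_le_one (fun z _ => ?_) fun z _ hz => ?_).trans_eq (one_mul _))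
        · rw [norm_pow, Real.norm_of_nonneg (hχ01 z).1]
          exact pow_le_one₀ (hχ01 z).1 (hχ01 z).2
        · simp [image_eq_zero_of_notMem_tsupport hz]
    have h2 := ρ.re_inner_realMul_le ξ g (fibreIntegral β hw hwc)
      (fun x y hxy => by rw [fibreIntegral_apply, fibreIntegral_apply, hxy]) (B := M ^ 2 * B₂)
      fun x => by
        refine (Real.le_norm_self _).trans (β.norm_integral_le_of_measure_le hJ
          (hKB _) (by positivity) (fun z _ => ?_) fun z _ hz => hw0 z hz)
        rw [norm_pow, norm_norm]
        gcongr
        exact hM _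
    have hkk : ρ.toLin (conv β 1 h g) ξ = ρ.toLin h (ρ.toLin g ξ) := by
      rw [ρ.map_conv]; rfl
    rw [hkk] at h0 h1
    set X := ‖ρ.toLin g ξ‖
    set Y := ‖ρ.toLin h (ρ.toLin g ξ)‖
    have h3 : Y ^ 2 ≤ (Real.sqrt (B₁ * B₂) * M * X) ^ 2 := by
      have h4 : 0 ≤ B₁⁻¹ ^ 2 * (B₁ * Y ^ 2) - 2 * B₁⁻¹ * Y ^ 2 + M ^ 2 * B₂ * X ^ 2 := by
        have := mul_le_mul_of_nonneg_left h1 (sq_nonneg B₁⁻¹)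
        linarith
      have h5 : B₁⁻¹ ^ 2 * (B₁ * Y ^ 2) - 2 * B₁⁻¹ * Y ^ 2 = -(B₁⁻¹ * Y ^ 2) := by
        field_simp; ring
      rw [h5] at h4
      have h6 : B₁ * (B₁⁻¹ * Y ^ 2) ≤ B₁ * (M ^ 2 * B₂ * X ^ 2) :=
        mul_le_mul_of_nonneg_left (by linarith) hB₁.le
      rw [mul_inv_cancel_left₀ hB₁.ne'] at h6
      rw [mul_pow, mul_pow, Real.sq_sqrt (by positivity)]
      linarith
    exact (sq_le_sq₀ (norm_nonneg _) (by positivity)).1 h3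
  -- The bound holds on the ranges of the operators `ρ(g)`, which need not be dense. The choice `g =
  -- h^*` suffices: it bounds `ρ(h)ρ(h)^*`, whose norm is `‖ρ(h)‖²`.
  have hsq : ‖ρ.toLin h‖ * ‖ρ.toLin h‖ ≤ Real.sqrt (B₁ * B₂) * M * ‖ρ.toLin h‖ := by
    rw [← CStarRing.norm_self_mul_star]
    refine ContinuousLinearMap.opNorm_le_bound _ (by positivity) fun ξ => ?_
    have := hle (invol 1 h) ξ
    rw [ρ.map_invol] at this
    refine this.trans ?_
    rw [mul_assoc (Real.sqrt (B₁ * B₂) * M)]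
    gcongr
    refine (ContinuousLinearMap.le_opNorm _ _).trans_eq ?_
    rw [norm_star]
  by_cases hz : ‖ρ.toLin h‖ = 0
  · rw [hz]; positivity
  · exact le_of_mul_le_mul_right hsq (lt_of_le_of_ne (norm_nonneg _) (Ne.symm hz))

theorem finiteNorm_one (β : HaarSystem E) (f : C_c(E, ℂ)) : FiniteNorm β 1 f := by
  obtain ⟨C, -, hC⟩ := exists_norm_toLin_le β f.hasCompactSupport.isCompact
  refine ⟨C * ‖f.toBoundedContinuousFunction‖, ?_⟩
  rintro _ ⟨ρ, rfl⟩
  exact hC ρ f subset_rfl _ (norm_nonneg _)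
    f.toBoundedContinuousFunction.norm_coe_le_norm

/-- Makes uniform approximation with supports in a fixed compact set an approximation in `C*(E)`. -/
theorem exists_norm_toCStar_le (β : HaarSystem E) {K : Set E} (hK : IsCompact K) :
    ∃ C : ℝ, 0 ≤ C ∧ ∀ (h : C_c(E, ℂ)), tsupport h ⊆ K → ∀ M : ℝ, 0 ≤ M →
      (∀ x, ‖h x‖ ≤ M) → ‖toCStar β 1 h‖ ≤ C * M := by
  obtain ⟨C, hC0, hC⟩ := exists_norm_toLin_le β hK
  refine ⟨C, hC0, fun h hh M hM0 hM => ?_⟩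
  rw [norm_toCStar β 1 (finiteNorm_one β h)]
  exact Real.iSup_le (fun ρ => hC ρ h hh M hM0 hM) (mul_nonneg hC0 hM0)

end Bound

/-! ### Homomorphisms of convolution algebras and the induced maps of `C*`-algebras. -/

section Functoriality

/-- A linear map between spaces of compactly supported functions that sends supports in a compact
set into a compact set and does not increase the uniform norm is continuous for the inductive limit
topologies. -/
theorem continuous_inductiveLimitTopology {X Y : Type u} [TopologicalSpace X] [TopologicalSpace Y]
    (T : C_c(X, ℂ) →ₗ[ℂ] C_c(Y, ℂ))
    (hsupp : ∀ K : Set X, IsCompact K → ∃ K' : Set Y, IsCompact K' ∧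
      ∀ f : C_c(X, ℂ), tsupport f ⊆ K → tsupport (T f) ⊆ K')
    (hnorm : ∀ (f : C_c(X, ℂ)) (M : ℝ), (∀ x, ‖f x‖ ≤ M) → ∀ y, ‖T f y‖ ≤ M) :
    @Continuous _ _ (inductiveLimitTopology X) (inductiveLimitTopology Y) T := by
  refine continuous_sInf_rng.2 fun t ht => ?_
  obtain ⟨h1, h2, h3, h4⟩ := ht
  -- The pullback along `T` of a topology admissible on `C_c(Y)` is admissible on `C_c(X)`, hence is
  -- coarser than the inductive limit topology.
  refine continuous_iff_le_induced.2 (sInf_le ⟨?_, ?_, ?_, fun K hK => ?_⟩)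
  · exact @topologicalAddGroup_induced _ _ t _ h1 _ _ _ _ T
  · exact @continuousSMul_induced _ _ _ _ _ _ t h2 _ _ _ T
  · exact @LocallyConvexSpace.induced _ _ _ _ _ _ _ _ _ t h3 (T.restrictScalars ℝ)
  · obtain ⟨K', hK', hT⟩ := hsupp K hK
    refine continuous_induced_rng.2 ?_
    refine @Continuous.comp {f : C_c(X, ℂ) // tsupport f ⊆ K} {f : C_c(Y, ℂ) // tsupport f ⊆ K'} _
      (TopologicalSpace.induced (fun f => f.1.toBoundedContinuousFunction) inferInstance)
      (TopologicalSpace.induced (fun f => f.1.toBoundedContinuousFunction) inferInstance) t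
      (fun f => ⟨T f.1, hT f.1 f.2⟩) Subtype.val (h4 K' hK') ?_
    refine continuous_induced_rng.2 ?_
    let tK : TopologicalSpace {f : C_c(X, ℂ) // tsupport f ⊆ K} :=
      TopologicalSpace.induced (fun f => f.1.toBoundedContinuousFunction) inferInstance
    have hι : Continuous fun f : {f : C_c(X, ℂ) // tsupport f ⊆ K} =>
        f.1.toBoundedContinuousFunction := continuous_induced_dom
    refine continuous_iff_continuousAt.2 fun f => ?_
    refine tendsto_iff_dist_tendsto_zero.2 (squeeze_zero (fun _ => dist_nonneg) (fun g => ?_)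
      (tendsto_iff_dist_tendsto_zero.1 (hι.tendsto f)))
    refine (BoundedContinuousFunction.dist_le dist_nonneg).2 fun y => ?_
    rw [dist_eq_norm]
    have := hnorm (g.1 - f.1)
      (dist g.1.toBoundedContinuousFunction f.1.toBoundedContinuousFunction) (fun x => by
        have := BoundedContinuousFunction.dist_coe_le_dist (f := g.1.toBoundedContinuousFunction)
          (g := f.1.toBoundedContinuousFunction) x
        rwa [dist_eq_norm] at this) y
    rw [map_sub] at this
    exact this

variable {E : Type u} [TopologicalSpace E] [ArrowGroupoid E] [MeasurableSpace E]
  [TopologicalGroupoid E] [SecondCountableTopology E] [LocallyCompactSpace E] [T2Space E]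
  [BorelSpace E]
  {E' : Type u} [TopologicalSpace E'] [ArrowGroupoid E'] [MeasurableSpace E']
  [TopologicalGroupoid E'] [SecondCountableTopology E'] [LocallyCompactSpace E'] [T2Space E']
  [BorelSpace E']

/-- A `*`-homomorphism `C_c(E, σ) → C_c(E', σ')` that is continuous for the inductive limit
topologies. -/
structure ConvHom (β : HaarSystem E) (σ : TwoCocycle E) (β' : HaarSystem E')
    (σ' : TwoCocycle E') where
  toLin : C_c(E, ℂ) →ₗ[ℂ] C_c(E', ℂ)
  map_conv : ∀ f g, toLin (conv β σ f g) = conv β' σ' (toLin f) (toLin g)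
  map_invol : ∀ f, toLin (invol σ f) = invol σ' (toLin f)
  continuous : @Continuous _ _ (inductiveLimitTopology E) (inductiveLimitTopology E') toLin

variable {β : HaarSystem E} {σ : TwoCocycle E} {β' : HaarSystem E'} {σ' : TwoCocycle E'}

/-- The composition of a representation with a homomorphism of convolution algebras. -/
noncomputable def Rep.comp (ρ : Rep β' σ') (T : ConvHom β σ β' σ') : Rep β σ where
  H := ρ.H
  toLin := ρ.toLin ∘ₗ T.toLin
  map_conv f g := by simp [T.map_conv, ρ.map_conv]
  map_invol f := by simp [T.map_invol, ρ.map_invol]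
  continuous_wot := @Continuous.comp _ _ _ (inductiveLimitTopology E) (inductiveLimitTopology E')
    _ _ _ ρ.continuous_wot T.continuous

/-- Every representation of the target pulls back to one of the source, so the supremum at `T f`
runs over values already present in the supremum at `f`. -/
theorem FiniteNorm.map (T : ConvHom β σ β' σ') {f : C_c(E, ℂ)} (h : FiniteNorm β σ f) :
    FiniteNorm β' σ' (T.toLin f) := by
  obtain ⟨C, hC⟩ := h
  refine ⟨C, ?_⟩
  rintro _ ⟨ρ, rfl⟩
  exact hC ⟨ρ.comp T, rfl⟩

theorem continuous_nonUnitalStarAlgHom {A B : Type*} [NonUnitalCStarAlgebra A]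
    [NonUnitalCStarAlgebra B] (φ : A →⋆ₙₐ[ℂ] B) : Continuous φ :=
  AddMonoidHomClass.continuous_of_bound φ 1 fun a => by
    rw [one_mul]; exact NonUnitalStarAlgHom.norm_apply_le φ a

/-- The restriction of a `*`-homomorphism of `C*`-algebras to the closures of two
`*`-subalgebras. -/
def restrictClosure {A B : Type*} [NonUnitalCStarAlgebra A] [NonUnitalCStarAlgebra B]
    (φ : A →⋆ₙₐ[ℂ] B) (S : NonUnitalStarSubalgebra ℂ A) (T : NonUnitalStarSubalgebra ℂ B)
    (h : ∀ a ∈ S, φ a ∈ T) : S.topologicalClosure →⋆ₙₐ[ℂ] T.topologicalClosure where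
  toFun a := ⟨φ a.1, map_mem_closure (continuous_nonUnitalStarAlgHom φ) a.2 h⟩
  map_smul' c a := Subtype.ext (map_smul φ c a.1)
  map_zero' := Subtype.ext (map_zero φ)
  map_add' a b := Subtype.ext (map_add φ a.1 b.1)
  map_mul' a b := Subtype.ext (map_mul φ a.1 b.1)
  map_star' a := Subtype.ext (map_star φ a.1)

/-- The reindexing of bounded families along `ρ ↦ ρ ∘ T`. -/
noncomputable def reindexFamily (T : ConvHom β σ β' σ') :
    lp (fun ρ : Rep β σ => ρ.Op) ∞ →⋆ₙₐ[ℂ] lp (fun ρ : Rep β' σ' => ρ.Op) ∞ where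
  toFun a := ⟨fun ρ => (a (ρ.comp T) : ρ.H →L[ℂ] ρ.H), memℓp_infty ⟨‖a‖, by
    rintro _ ⟨ρ, rfl⟩
    exact lp.norm_apply_le_norm ENNReal.top_ne_zero a (ρ.comp T)⟩⟩
  map_smul' _ _ := lp.ext (funext fun _ => rfl)
  map_zero' := lp.ext (funext fun _ => rfl)
  map_add' _ _ := lp.ext (funext fun _ => rfl)
  map_mul' _ _ := lp.ext (funext fun _ => rfl)
  map_star' _ := lp.ext (funext fun _ => rfl)

/-- The homomorphism of `C*`-algebras induced by a homomorphism of convolution algebras. -/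
noncomputable def CStar.map (T : ConvHom β σ β' σ') : CStar β σ →⋆ₙₐ[ℂ] CStar β' σ' :=
  restrictClosure (reindexFamily T) (universalImage β σ) (universalImage β' σ')
    fun _ ⟨f, hf⟩ => ⟨T.toLin f, fun ρ => hf (ρ.comp T)⟩

theorem CStar.map_toCStar (T : ConvHom β σ β' σ') {f : C_c(E, ℂ)} (h : FiniteNorm β σ f) :
    CStar.map T (toCStar β σ f) = toCStar β' σ' (T.toLin f) := by
  rw [toCStar, toCStar, dif_pos h, dif_pos (h.map T)]
  rfl

theorem toCStar_add {f g : C_c(E, ℂ)} (hf : FiniteNorm β σ f) (hg : FiniteNorm β σ g)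
    (hfg : FiniteNorm β σ (f + g)) :
    toCStar β σ (f + g) = toCStar β σ f + toCStar β σ g := by
  rw [toCStar, toCStar, toCStar, dif_pos hf, dif_pos hg, dif_pos hfg]
  exact Subtype.ext (lp.ext (funext fun ρ => map_add ρ.toLin f g))

theorem toCStar_conv {f g : C_c(E, ℂ)} (hf : FiniteNorm β σ f) (hg : FiniteNorm β σ g)
    (hfg : FiniteNorm β σ (conv β σ f g)) :
    toCStar β σ (conv β σ f g) = toCStar β σ f * toCStar β σ g := by
  rw [toCStar, toCStar, toCStar, dif_pos hf, dif_pos hg, dif_pos hfg]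
  exact Subtype.ext (lp.ext (funext fun ρ => ρ.map_conv f g))

theorem toCStar_zero : toCStar β σ 0 = 0 := by
  rw [toCStar]
  split_ifs with h
  · exact Subtype.ext (lp.ext (funext fun ρ => map_zero ρ.toLin))
  · rfl

theorem toCStar_sub {f g : C_c(E, ℂ)} (hf : FiniteNorm β σ f) (hg : FiniteNorm β σ g)
    (hfg : FiniteNorm β σ (f - g)) :
    toCStar β σ (f - g) = toCStar β σ f - toCStar β σ g := by
  rw [toCStar, toCStar, toCStar, dif_pos hf, dif_pos hg, dif_pos hfg]
  exact Subtype.ext (lp.ext (funext fun ρ => map_sub ρ.toLin f g))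

end Functoriality

/-! ### Characters of the circle. -/

section Circle

theorem zpow_cocycle_apply {G : Type u} [TopologicalSpace G] [ArrowGroupoid G]
    (ω : TwoCocycle G) (n : ℤ) (γ η : G) : (ω ^ n) γ η = ω γ η ^ n := rfl

theorem continuous_zpow_coe (n : ℤ) : Continuous fun t : Circle => ((t ^ n : Circle) : ℂ) :=
  continuous_circle_coe.comp (continuous_zpow n)

theorem conj_circle_coe (t : Circle) : (starRingEnd ℂ) (t : ℂ) = ((t⁻¹ : Circle) : ℂ) :=
  (Circle.coe_inv_eq_conj t).symm

theorem integral_circle_zpow (k : ℤ) :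
    ∫ t : Circle, ((t ^ k : Circle) : ℂ) ∂circleHaar = if k = 0 then 1 else 0 := by
  split_ifs with hk
  · subst hk
    simp
  -- Here `z ^ k = -1`, so translation by `z` shows that the integral equals its own negative.
  · set z : Circle := Circle.exp (Real.pi / k) with hz
    have hzk : ((z ^ k : Circle) : ℂ) = -1 := by
      rw [hz, ← Circle.exp_zsmul, zsmul_eq_mul,
        mul_div_cancel₀ _ (Int.cast_ne_zero.2 hk), Circle.coe_exp,
        Complex.exp_pi_mul_I]
    have h1 := integral_mul_left_eq_self (μ := circleHaar)
      (fun t : Circle => ((t ^ k : Circle) : ℂ)) z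
    simp only [mul_zpow, Circle.coe_mul, hzk, integral_const_mul] at h1
    linear_combination (-1 / 2 : ℂ) * h1

theorem integrable_circle {f : Circle → ℂ} (hf : Continuous f) : Integrable f circleHaar :=
  hf.integrable_of_hasCompactSupport (HasCompactSupport.of_compactSpace f)

end Circle

namespace Ext

/-! ### Fourier coefficients on `G^ω` and the twisted algebras. -/

section Components

variable {G : Type u} [TopologicalSpace G] [ArrowGroupoid G] [TopologicalGroupoid G]
  [SecondCountableTopology G] [LocallyCompactSpace G] [T2Space G] [MeasurableSpace G]
  [BorelSpace G] {ω : TwoCocycle G}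

/-- The cocycle identity for `(η, η⁻¹, γ)`, with `ω(ηη⁻¹, γ) = 1`, combines `ω(η, η⁻¹)⁻¹ ω(η⁻¹, γ)`
into `ω(η, η⁻¹γ)⁻¹`. This is the source of the twist in the components. -/
theorem mk_inv_mul_mk {η γ : G} (h : rng η = rng γ) (s t : Circle) :
    (mk ω s η)⁻¹ * mk ω t γ = mk ω (s⁻¹ * t * (ω η (η⁻¹ * γ))⁻¹) (η⁻¹ * γ) := by
  refine Ext.ext ?_ rfl
  change s⁻¹ * (ω η η⁻¹)⁻¹ * t * ω η⁻¹ γ = s⁻¹ * t * (ω η (η⁻¹ * γ))⁻¹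
  have hc := ω.cocycle' η η⁻¹ γ (rng_inv η).symm ((src_inv η).trans h)
  have h1 : ω (η * η⁻¹) γ = 1 := by
    have := ω.map_rng' γ
    rwa [← h] at this
  rw [h1, mul_one] at hc
  rw [hc, mul_inv_rev]
  calc s⁻¹ * ((ω η (η⁻¹ * γ))⁻¹ * (ω η⁻¹ γ)⁻¹) * t * ω η⁻¹ γ
      = s⁻¹ * t * (ω η (η⁻¹ * γ))⁻¹ * ((ω η⁻¹ γ)⁻¹ * ω η⁻¹ γ) := by
        simp only [mul_assoc, mul_left_comm, mul_comm]
    _ = _ := by rw [_root_.inv_mul_cancel, mul_one]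

theorem upsilon_apply (n : ℤ) (F : C_c(Ext ω, ℂ)) (γ : G) :
    upsilon n F γ = ∫ t : Circle, F (mk ω t γ) * ((t ^ n : Circle) : ℂ) ∂circleHaar := rfl

theorem continuous_mk_left (γ : G) : Continuous fun t : Circle => mk ω t γ :=
  continuous_mk.comp (Continuous.prodMk_left γ)

theorem integrable_upsilon (n : ℤ) (F : C_c(Ext ω, ℂ)) (γ : G) :
    Integrable (fun t : Circle => F (mk ω t γ) * ((t ^ n : Circle) : ℂ)) circleHaar :=
  integrable_circle ((F.continuous.comp (continuous_mk_left γ)).mul (continuous_zpow_coe n))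

/-- The map `Υ_n`, as a linear map. -/
noncomputable def upsilonLin (n : ℤ) : C_c(Ext ω, ℂ) →ₗ[ℂ] C_c(G, ℂ) where
  toFun := upsilon n
  map_add' F F' := by
    ext γ
    rw [CompactlySupportedContinuousMap.add_apply, upsilon_apply, upsilon_apply, upsilon_apply,
      ← integral_add (integrable_upsilon n F γ) (integrable_upsilon n F' γ)]
    exact integral_congr_ae (Eventually.of_forall fun t => add_mul _ _ _)
  map_smul' c F := by
    ext γ
    rw [RingHom.id_apply, CompactlySupportedContinuousMap.smul_apply, upsilon_apply,
      upsilon_apply, smul_eq_mul, ← integral_const_mul]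
    exact integral_congr_ae (Eventually.of_forall fun t => mul_assoc _ _ _)

theorem upsilon_eq_zero (n : ℤ) {F : C_c(Ext ω, ℂ)} {K : Set (Ext ω)} (hF : tsupport F ⊆ K)
    {γ : G} (hγ : γ ∉ arr '' K) : upsilon n F γ = 0 := by
  have h : ∀ t : Circle, F (mk ω t γ) = 0 := fun t =>
    image_eq_zero_of_notMem_tsupport fun h => hγ ⟨mk ω t γ, hF h, rfl⟩
  simp [upsilon_apply, h]

theorem continuous_upsilonLin (n : ℤ) :
    @Continuous _ _ (inductiveLimitTopology (Ext ω)) (inductiveLimitTopology G)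
      (upsilonLin (ω := ω) n) := by
  refine continuous_inductiveLimitTopology _ (fun K hK => ⟨arr '' K, hK.image continuous_arr,
    fun F hF => tsupport_subset_of_isCompact (hK.image continuous_arr) fun γ hγ =>
      upsilon_eq_zero n hF hγ⟩) fun F M hM γ => ?_
  change ‖upsilon n F γ‖ ≤ M
  rw [upsilon_apply]
  refine (norm_integral_le_of_norm_le_const (Eventually.of_forall fun t => ?_)).trans_eq
    (by simp : M * circleHaar.real Set.univ = M)
  rw [norm_mul, Circle.norm_coe, mul_one]
  exact hM _

theorem isCompact_arr_preimage {K : Set G} (hK : IsCompact K) :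
    IsCompact (arr ⁻¹' K : Set (Ext ω)) := by
  have h : IsCompact ((Set.univ : Set Circle) ×ˢ K) := isCompact_univ.prod hK
  rw [Set.univ_prod] at h
  exact h

/-- The function `(t, γ) ↦ t⁻ⁿ f(γ)`. -/
noncomputable def embed (ω : TwoCocycle G) (n : ℤ) : C_c(G, ℂ) →ₗ[ℂ] C_c(Ext ω, ℂ) where
  toFun f :=
    { toFun := fun a => ((a.circ ^ (-n) : Circle) : ℂ) * f a.arr
      continuous_toFun := ((continuous_zpow_coe (-n)).comp continuous_circ).mul
        (f.continuous.comp continuous_arr)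
      hasCompactSupport' := by
        refine HasCompactSupport.intro
          (isCompact_arr_preimage f.hasCompactSupport.isCompact) fun a ha => ?_
        rw [image_eq_zero_of_notMem_tsupport fun h => ha h, mul_zero] }
  map_add' f g := by
    ext a
    exact mul_add _ _ _
  map_smul' c f := by
    ext a
    exact mul_left_comm _ _ _

theorem embed_apply (n : ℤ) (f : C_c(G, ℂ)) (a : Ext ω) :
    embed ω n f a = ((a.circ ^ (-n) : Circle) : ℂ) * f a.arr := rfl

theorem embed_mk (n : ℤ) (f : C_c(G, ℂ)) (t : Circle) (γ : G) :
    embed ω n f (mk ω t γ) = ((t ^ (-n) : Circle) : ℂ) * f γ := rfl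

theorem continuous_embed (n : ℤ) :
    @Continuous _ _ (inductiveLimitTopology G) (inductiveLimitTopology (Ext ω)) (embed ω n) := by
  refine continuous_inductiveLimitTopology _ (fun K hK => ⟨arr ⁻¹' K, isCompact_arr_preimage hK,
    fun f hf => tsupport_subset_of_isCompact (isCompact_arr_preimage hK) fun a ha => ?_⟩)
    fun f M hM a => ?_
  · rw [embed_apply, image_eq_zero_of_notMem_tsupport fun h => ha (hf h), mul_zero]
  · rw [embed_apply, norm_mul, Circle.norm_coe, one_mul]
    exact hM _

/-- Orthogonality of characters; the exponent `-n` in `embed` is chosen to cancel the `tⁿ` in `Υ_n`.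
-/
theorem upsilon_embed (m n : ℤ) (f : C_c(G, ℂ)) :
    upsilon m (embed ω n f) = if m = n then f else 0 := by
  ext γ
  have : ∀ t : Circle, embed ω n f (mk ω t γ) * ((t ^ m : Circle) : ℂ) =
      ((t ^ (m - n) : Circle) : ℂ) * f γ := fun t => by
    rw [embed_mk, sub_eq_neg_add, zpow_add, Circle.coe_mul]
    ring
  rw [upsilon_apply]
  simp only [this]
  rw [integral_mul_const, integral_circle_zpow]
  simp only [sub_eq_zero]
  split_ifs <;> simp

theorem upsilon_invol (n : ℤ) (F : C_c(Ext ω, ℂ)) :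
    upsilon n (invol 1 F) = invol (ω ^ n) (upsilon n F) := by
  ext γ
  rw [invol_apply, upsilon_apply, upsilon_apply, zpow_cocycle_apply, ← integral_conj,
    ← integral_mul_const]
  set f : Circle → ℂ := fun t => (starRingEnd ℂ) (F (mk ω t γ⁻¹) * ((t ^ n : Circle) : ℂ)) *
    (starRingEnd ℂ) ((ω γ γ⁻¹ ^ n : Circle) : ℂ) with hf
  -- Haar measure is invariant under `t ↦ (ω(γ, γ⁻¹) t)⁻¹`, the circle component of `(t, γ)⁻¹`.
  have h1 : ∫ t : Circle, f ((ω γ γ⁻¹ * t)⁻¹) ∂circleHaar = ∫ t, f t ∂circleHaar :=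
    (integral_mul_left_eq_self (fun t : Circle => f t⁻¹) (ω γ γ⁻¹)).trans
      (integral_inv_eq_self f circleHaar)
  rw [← h1]
  refine integral_congr_ae (Eventually.of_forall fun t => ?_)
  have h2 : (mk ω t γ)⁻¹ = mk ω (ω γ γ⁻¹ * t)⁻¹ γ⁻¹ := by
    rw [inv_def, mul_inv]
    exact Ext.ext (mul_comm _ _) rfl
  simp only [hf, invol_one_apply, h2, map_mul, conj_circle_coe]
  rw [mul_assoc, ← Circle.coe_mul]
  congr 3
  rw [inv_zpow, _root_.inv_inv, mul_zpow, mul_comm (ω γ γ⁻¹ ^ n), _root_.mul_inv_cancel_right]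

theorem embed_invol (n : ℤ) (f : C_c(G, ℂ)) :
    embed ω n (invol (ω ^ n) f) = invol 1 (embed ω n f) := by
  ext a
  rw [invol_one_apply, embed_apply, embed_apply, invol_apply, zpow_cocycle_apply, map_mul,
    conj_circle_coe, conj_circle_coe]
  change _ = (((a.circ⁻¹ * (ω a.arr a.arr⁻¹)⁻¹) ^ (-n))⁻¹ : Circle) * (starRingEnd ℂ) (f a.arr⁻¹)
  rw [mul_left_comm, ← Circle.coe_mul, mul_comm]
  congr 2
  rw [mul_zpow, inv_zpow, inv_zpow, mul_inv, _root_.inv_inv, _root_.inv_inv, zpow_neg, zpow_neg]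

theorem conv_mk (lam : HaarSystem G) (F F' : C_c(Ext ω, ℂ)) (t : Circle) (γ : G) :
    conv (haarSystem lam ω) 1 F F' (mk ω t γ) =
      ∫ p : Circle × G, F (mk ω p.1 p.2) *
        F' (mk ω (p.1⁻¹ * t * (ω p.2 (p.2⁻¹ * γ))⁻¹) (p.2⁻¹ * γ))
        ∂(circleHaar.prod (lam.meas (rngU γ))) := by
  rw [conv_one_apply]
  have hm : (haarSystem lam ω).meas (rngU (mk ω t γ)) =
      circleHaar.prod (lam.meas (rngU γ)) :=
    congrArg (fun u => circleHaar.prod (lam.meas u)) (unitProj_rngU (mk ω t γ))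
  rw [hm]
  refine integral_congr_ae ?_
  have h : ∀ᵐ p : Circle × G ∂(circleHaar.prod (lam.meas (rngU γ))), rngU p.2 = rngU γ :=
    Measure.quasiMeasurePreserving_snd.ae (lam.ae_rngU _)
  filter_upwards [h] with p hp
  have := mk_inv_mul_mk (ω := ω) (congrArg Subtype.val hp) p.1 t
  exact congrArg (fun x => F p * F' x) this

/-- The integrand separates: the circle variable enters only through `s^{n-m}`, whose integral is
`δ_{mn}`, while the `-n`-th power of `ω⁻¹` is the twist. The case `m ≠ n` makes the summands
orthogonal. -/
theorem conv_embed (lam : HaarSystem G) (m n : ℤ) (f g : C_c(G, ℂ)) :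
    conv (haarSystem lam ω) 1 (embed ω m f) (embed ω n g) =
      if m = n then embed ω n (conv lam (ω ^ n) f g) else 0 := by
  ext a
  change conv (haarSystem lam ω) 1 (embed ω m f) (embed ω n g) (mk ω a.circ a.arr) = _
  rw [conv_mk]
  have h1 : ∀ p : Circle × G, embed ω m f (mk ω p.1 p.2) * embed ω n g
      (mk ω (p.1⁻¹ * a.circ * (ω p.2 (p.2⁻¹ * a.arr))⁻¹) (p.2⁻¹ * a.arr)) =
      ((p.1 ^ (n - m) : Circle) : ℂ) * (((a.circ ^ (-n) : Circle) : ℂ) *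
        (f p.2 * g (p.2⁻¹ * a.arr) * ((ω ^ n) p.2 (p.2⁻¹ * a.arr) : ℂ))) := fun p => by
    rw [embed_mk, embed_mk, zpow_cocycle_apply, mul_zpow, mul_zpow, inv_zpow', inv_zpow',
      neg_neg, sub_eq_add_neg, zpow_add]
    simp only [Circle.coe_mul]
    ring
  simp only [h1]
  rw [integral_prod_mul (fun t : Circle => ((t ^ (n - m) : Circle) : ℂ))
    (fun η => ((a.circ ^ (-n) : Circle) : ℂ) *
      (f η * g (η⁻¹ * a.arr) * ((ω ^ n) η (η⁻¹ * a.arr) : ℂ))), integral_circle_zpow,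
    integral_const_mul, ← conv_apply]
  simp only [sub_eq_zero, eq_comm (a := n)]
  split_ifs
  · rw [one_mul, embed_apply]
  · rw [zero_mul]; rfl

/-- After Fubini, the substitution `t ↦ s ω(η, η⁻¹γ) t` in the inner circle integral splits `tⁿ`
into `sⁿ`, completing `Υ_n(F)`, the twist `ω^n`, and `tⁿ`, completing `Υ_n(F')`. -/
theorem upsilon_conv (lam : HaarSystem G) (n : ℤ) (F F' : C_c(Ext ω, ℂ)) :
    upsilon n (conv (haarSystem lam ω) 1 F F') =
      conv lam (ω ^ n) (upsilon n F) (upsilon n F') := by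
  ext γ
  set κ : G → Circle := fun η => ω η (η⁻¹ * γ) with hκ
  set H : Circle → Circle × G → ℂ := fun t p => F (mk ω p.1 p.2) *
    F' (mk ω (p.1⁻¹ * t * (κ p.2)⁻¹) (p.2⁻¹ * γ)) * ((t ^ n : Circle) : ℂ) with hH
  set L : Set G := arr '' tsupport F with hL
  have hLc : IsCompact L := F.hasCompactSupport.isCompact.image continuous_arr
  have hFL : ∀ s, ∀ η ∉ L, F (mk ω s η) = 0 := fun s η hη =>
    image_eq_zero_of_notMem_tsupport fun h => hη ⟨_, h, rfl⟩
  have hκc : ContinuousOn κ {η | rngU η = rngU γ} := by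
    refine ω.continuousOn'.comp (continuousOn_id.prodMk (continuousOn_inv_mul_right γ)) ?_
    intro η hη
    change src η = rng (η⁻¹ * γ)
    exact (congrArg Subtype.val (rngU_inv_mul hη)).symm
  have hFc : Continuous fun p : Circle × G => F (mk ω p.1 p.2) := F.continuous.comp continuous_mk
  have hDc : IsClosed {p : Circle × (Circle × G) | rngU p.2.2 = rngU γ} :=
    (isClosed_fibre (rngU γ)).preimage (continuous_snd.comp continuous_snd)
  have h22 : Set.MapsTo (fun p : Circle × (Circle × G) => p.2.2)
      {p : Circle × (Circle × G) | rngU p.2.2 = rngU γ} {η | rngU η = rngU γ} := fun p hp => hp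
  have c22 : ContinuousOn (fun p : Circle × (Circle × G) => p.2.2)
      {p : Circle × (Circle × G) | rngU p.2.2 = rngU γ} :=
    (continuous_snd.comp continuous_snd).continuousOn
  have hHc : ContinuousOn (Function.uncurry H) {p | rngU p.2.2 = rngU γ} := by
    have hk : ContinuousOn (fun p : Circle × (Circle × G) => κ p.2.2)
      {p | rngU p.2.2 = rngU γ} := hκc.comp c22 h22
    refine ContinuousOn.mul (ContinuousOn.mul (hFc.comp continuous_snd).continuousOn ?_)
      ((continuous_zpow_coe n).comp continuous_fst).continuousOn
    refine (F'.continuous.comp continuous_mk).comp_continuousOn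
      (ContinuousOn.prodMk (ContinuousOn.mul ?_ hk.inv)
        ((continuousOn_inv_mul_right γ).comp c22 h22))
    exact ((continuous_fst.comp continuous_snd).inv.mul continuous_fst).continuousOn
  have hHi : Integrable (Function.uncurry H)
      (circleHaar.prod (circleHaar.prod (lam.meas (rngU γ)))) := by
    obtain ⟨Φ, hΦ⟩ := exists_compactlySupported_eqOn hDc
      ((isCompact_univ (X := Circle)).prod ((isCompact_univ (X := Circle)).prod hLc)) hHc (by
        rintro ⟨t, s, η⟩ - hne
        have : η ∉ L := fun h => hne ⟨Set.mem_univ _, Set.mem_univ _, h⟩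
        simp [hH, hFL s η this])
    refine (Φ.continuous.integrable_of_hasCompactSupport Φ.hasCompactSupport).congr ?_
    have h1 : ∀ᵐ p ∂(circleHaar.prod (lam.meas (rngU γ))), rngU p.2 = rngU γ :=
      Measure.quasiMeasurePreserving_snd.ae (lam.ae_rngU _)
    have h2 : ∀ᵐ p ∂(circleHaar.prod (circleHaar.prod (lam.meas (rngU γ)))),
        rngU p.2.2 = rngU γ := Measure.quasiMeasurePreserving_snd.ae h1
    exact h2.mono fun p hp => hΦ hp
  have hinner : ∀ p : Circle × G, ∫ t, H t p ∂circleHaar =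
      F (mk ω p.1 p.2) * ((p.1 ^ n : Circle) : ℂ) *
        (upsilon n F' (p.2⁻¹ * γ) * ((ω ^ n) p.2 (p.2⁻¹ * γ) : ℂ)) := by
    intro p
    -- The translation by `s κ(η)` clears the circle argument of `F'` down to `t`.
    rw [← integral_mul_left_eq_self _ (p.1 * κ p.2), zpow_cocycle_apply, upsilon_apply,
      ← integral_mul_const, ← integral_const_mul]
    refine integral_congr_ae (Eventually.of_forall fun t => ?_)
    have h1 : p.1⁻¹ * (p.1 * κ p.2 * t) * (κ p.2)⁻¹ = t := by
      rw [mul_assoc p.1, _root_.inv_mul_cancel_left, mul_comm (κ p.2),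
        _root_.mul_inv_cancel_right]
    simp only [hH]
    rw [h1]
    simp only [mul_zpow, Circle.coe_mul, hκ]
    ring
  have hswap : upsilon n (conv (haarSystem lam ω) 1 F F') γ =
      ∫ p, ∫ t, H t p ∂circleHaar ∂(circleHaar.prod (lam.meas (rngU γ))) := by
    rw [← integral_integral_swap hHi, upsilon_apply]
    refine integral_congr_ae (Eventually.of_forall fun t => ?_)
    simp only [hH]
    rw [conv_mk, ← integral_mul_const]
  have hI : Integrable (fun p : Circle × G => F (mk ω p.1 p.2) * ((p.1 ^ n : Circle) : ℂ) *
      (upsilon n F' (p.2⁻¹ * γ) * ((ω ^ n) p.2 (p.2⁻¹ * γ) : ℂ)))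
      (circleHaar.prod (lam.meas (rngU γ))) :=
    hHi.integral_prod_right.congr (Eventually.of_forall hinner)
  rw [hswap, conv_apply]
  simp only [hinner]
  rw [integral_prod_symm _ hI]
  refine integral_congr_ae (Eventually.of_forall fun η => ?_)
  change ∫ s : Circle, F (mk ω s η) * ((s ^ n : Circle) : ℂ) *
    (upsilon n F' (η⁻¹ * γ) * ((ω ^ n) η (η⁻¹ * γ) : ℂ)) ∂circleHaar = _
  rw [integral_mul_const, ← upsilon_apply]
  exact (mul_assoc _ _ _).symm

/-- The map `Υ_n`, as a homomorphism of convolution algebras. -/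
noncomputable def upsilonHom (lam : HaarSystem G) (ω : TwoCocycle G) (n : ℤ) :
    ConvHom (haarSystem lam ω) 1 lam (ω ^ n) where
  toLin := upsilonLin n
  map_conv := upsilon_conv lam n
  map_invol := upsilon_invol n
  continuous := continuous_upsilonLin n

/-- The map `f ↦ t⁻ⁿ f`, as a homomorphism of convolution algebras. -/
noncomputable def embedHom (lam : HaarSystem G) (ω : TwoCocycle G) (n : ℤ) :
    ConvHom lam (ω ^ n) (haarSystem lam ω) 1 where
  toLin := embed ω n
  map_conv f g := by rw [conv_embed, if_pos rfl]
  map_invol := embed_invol n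
  continuous := continuous_embed n

end Components

end Ext

/-! ### Orthogonal retracts and `c₀`-direct sums. -/

section DirectSum

variable {I : Type*} {A : Type*} [NonUnitalCStarAlgebra A] {B : I → Type*}
  [∀ i, NonUnitalCStarAlgebra (B i)]

/-- A finite orthogonal sum of `*`-homomorphisms is contractive for the supremum norm. -/
theorem norm_sum_le_of_orthogonal [Fintype I] (J : ∀ i, B i →⋆ₙₐ[ℂ] A)
    (hJ : ∀ i j, i ≠ j → ∀ a b, J i a * J j b = 0) (a : ∀ i, B i) {C : ℝ} (hC : 0 ≤ C)
    (ha : ∀ i, ‖a i‖ ≤ C) : ‖∑ i, J i (a i)‖ ≤ C := by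
  classical
  -- Orthogonality makes the sum map multiplicative on the finite product, and a `*`-homomorphism of
  -- `C*`-algebras is contractive.
  let φ : (∀ i, B i) →⋆ₙₐ[ℂ] A :=
    { toFun := fun a => ∑ i, J i (a i)
      map_smul' := fun c a => by simp [Finset.smul_sum]
      map_zero' := by simp
      map_add' := fun a b => by simp [Finset.sum_add_distrib]
      map_mul' := fun a b => by
        rw [Finset.sum_mul_sum]
        refine Finset.sum_congr rfl fun i _ => ?_
        rw [Finset.sum_eq_single i (fun j _ hj => hJ i j hj.symm _ _) (by simp)]
        exact map_mul (J i) _ _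
      map_star' := fun a => by simp [star_sum, map_star] }
  exact (NonUnitalStarAlgHom.norm_apply_le φ a).trans ((pi_norm_le_iff_of_nonneg hC).2 ha)

/-- The vanishing of `a` off `s` is carried through the induction so that two sums can be rewritten
over the union of their index sets. -/
theorem exists_finset_sum_of_mem_closure (J : ∀ i, B i →⋆ₙₐ[ℂ] A) {x : A}
    (hx : x ∈ AddSubmonoid.closure {x : A | ∃ i b, x = J i b}) :
    ∃ (s : Finset I) (a : ∀ i, B i), (∀ i ∉ s, a i = 0) ∧ x = ∑ i ∈ s, J i (a i) := by
  classical
  induction hx using AddSubmonoid.closure_induction with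
  | mem x hx =>
    obtain ⟨i, b, rfl⟩ := hx
    refine ⟨{i}, Pi.single i b, fun j hj => ?_, by simp⟩
    exact Pi.single_eq_of_ne (by simpa using hj) b
  | zero => exact ⟨∅, 0, fun _ _ => rfl, by simp⟩
  | add x y _ _ hx hy =>
    obtain ⟨s, a, ha, rfl⟩ := hx
    obtain ⟨t, b, hb, rfl⟩ := hy
    refine ⟨s ∪ t, a + b, fun i hi => ?_, ?_⟩
    · rw [Finset.mem_union, not_or] at hi
      simp [ha i hi.1, hb i hi.2]
    · simp only [Pi.add_apply, map_add, Finset.sum_add_distrib]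
      congr 1
      · exact Finset.sum_subset Finset.subset_union_left fun i _ hi => by simp [ha i hi]
      · exact Finset.sum_subset Finset.subset_union_right fun i _ hi => by simp [hb i hi]

/-- A `C*`-algebra generated by orthogonal retracts `B i` is their `c₀`-direct sum. -/
theorem exists_starAlgEquiv_directSum (J : ∀ i, B i →⋆ₙₐ[ℂ] A) (U : ∀ i, A →⋆ₙₐ[ℂ] B i)
    (hUJ : ∀ i b, U i (J i b) = b) (hUJ' : ∀ i j, i ≠ j → ∀ b, U i (J j b) = 0)
    (hJ : ∀ i j, i ≠ j → ∀ a b, J i a * J j b = 0)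
    (hd : Dense (AddSubmonoid.closure {x : A | ∃ i b, x = J i b} : Set A)) :
    ∃ Φ : A ≃⋆ₐ[ℂ] directSum B, ∀ a i, (Φ a).1 i = U i a := by
  classical
  have hUs : ∀ (s : Finset I) (a : ∀ i, B i) (i : I), U i (∑ j ∈ s, J j (a j)) =
      if i ∈ s then a i else 0 := by
    intro s a i
    rw [map_sum]
    split_ifs with hi
    · rw [Finset.sum_eq_single i (fun j _ hj => hUJ' i j hj.symm _) (fun h => absurd hi h), hUJ]
    · exact Finset.sum_eq_zero fun j hj => hUJ' i j (fun h => hi (h ▸ hj)) _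
  have happ : ∀ (x : A) (ε : ℝ), 0 < ε → ∃ (s : Finset I) (a : ∀ i, B i),
      ‖x - ∑ i ∈ s, J i (a i)‖ < ε := by
    intro x ε hε
    obtain ⟨y, hy, hxy⟩ := Metric.mem_closure_iff.1 (hd x) ε hε
    obtain ⟨s, a, -, rfl⟩ := exists_finset_sum_of_mem_closure J hy
    exact ⟨s, a, by rwa [dist_eq_norm] at hxy⟩
  have hUle : ∀ i x, ‖U i x‖ ≤ ‖x‖ := fun i x => NonUnitalStarAlgHom.norm_apply_le (U i) x
  let ψ : A →⋆ₙₐ[ℂ] lp B ∞ :=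
    { toFun := fun x => ⟨fun i => U i x, memℓp_infty ⟨‖x‖, by
        rintro _ ⟨i, rfl⟩
        exact hUle i x⟩⟩
      map_smul' := fun c x => lp.ext (funext fun i => map_smul (U i) c x)
      map_zero' := lp.ext (funext fun i => map_zero (U i))
      map_add' := fun x y => lp.ext (funext fun i => map_add (U i) x y)
      map_mul' := fun x y => lp.ext (funext fun i => map_mul (U i) x y)
      map_star' := fun x => lp.ext (funext fun i => map_star (U i) x) }
  have hψ : ∀ x i, ψ x i = U i x := fun _ _ => rfl
  -- Off the finite index set of an approximating sum `d`, `U i x = U i (x - d)` is small.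
  have hψc₀ : ∀ x, ψ x ∈ directSum B := by
    intro x
    change Tendsto (fun i => ‖U i x‖) cofinite (𝓝 0)
    rw [Metric.tendsto_nhds]
    intro ε hε
    obtain ⟨s, a, hs⟩ := happ x ε hε
    refine (s.finite_toSet.subset fun i hi => ?_ : Set.Finite {i | ¬ dist ‖U i x‖ 0 < ε})
    by_contra his
    refine hi ?_
    have h0 : U i (x - ∑ j ∈ s, J j (a j)) = U i x := by
      rw [map_sub, hUs, if_neg (by simpa using his), sub_zero]
    rw [dist_zero_right, norm_norm, ← h0]
    exact (hUle _ _).trans_lt hs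
  -- The components of an approximating sum are `U i d`, hence within `ε / 2` of `U i x` and bounded
  -- by `‖ψ x‖ + ε / 2`; orthogonality passes this bound to `d`.
  have hψle : ∀ x, ‖x‖ ≤ ‖ψ x‖ := by
    intro x
    refine le_of_forall_pos_le_add fun ε hε => ?_
    obtain ⟨s, a, hs⟩ := happ x (ε / 2) (by positivity)
    set d := ∑ i ∈ s, J i (a i) with hd
    have h1 : ‖d‖ ≤ ‖ψ x‖ + ε / 2 := by
      have h2 := norm_sum_le_of_orthogonal (I := s) (fun i => J i)
        (fun i j hij => hJ i j fun h => hij (Subtype.ext h)) (fun i => a i)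
        (C := ‖ψ x‖ + ε / 2) (by positivity) fun i => by
          have h3 : a i = U i d := by rw [hd, hUs, if_pos i.2]
          have h4 : U i d = U i x - U i (x - d) := by rw [← map_sub, sub_sub_cancel]
          rw [h3, h4]
          exact (norm_sub_le _ _).trans (add_le_add
            (lp.norm_apply_le_norm ENNReal.top_ne_zero (ψ x) i) ((hUle _ _).trans hs.le))
      rwa [Finset.sum_coe_sort s (fun i => J i (a i))] at h2
    calc ‖x‖ = ‖(x - d) + d‖ := by rw [sub_add_cancel]
      _ ≤ ‖x - d‖ + ‖d‖ := norm_add_le _ _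
      _ ≤ ε / 2 + (‖ψ x‖ + ε / 2) := add_le_add hs.le h1
      _ = ‖ψ x‖ + ε := by ring
  have hψn : ∀ x, ‖ψ x‖ = ‖x‖ := fun x => le_antisymm
    (lp.norm_le_of_forall_le (norm_nonneg _) fun i => hUle i x) (hψle x)
  have hiso : Isometry ψ := AddMonoidHomClass.isometry_of_norm ψ hψn
  let Ψ : A →⋆ₙₐ[ℂ] directSum B := NonUnitalStarAlgHom.codRestrict ψ (directSum B) hψc₀
  have hΨ : ∀ x, (Ψ x).1 = ψ x := fun _ => rfl
  refine ⟨StarAlgEquiv.ofBijective Ψ ⟨fun x y hxy => hiso.injective ?_, fun b => ?_⟩,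
    fun a i => rfl⟩
  · rw [← hΨ, ← hΨ, hxy]
  -- Finite truncations of a `c₀` family lie in the range, which is closed because `ψ` is isometric.
  · have hb : b.1 ∈ closure (Set.range ψ) := by
      rw [Metric.mem_closure_iff]
      intro ε hε
      have hfin : Set.Finite {i | ¬ dist ‖b.1 i‖ 0 < ε / 2} :=
        (Metric.tendsto_nhds.1 b.2) (ε / 2) (by positivity)
      refine ⟨_, ⟨∑ i ∈ hfin.toFinset, J i (b.1 i), rfl⟩, ?_⟩
      refine lt_of_le_of_lt ?_ (half_lt_self hε)
      rw [dist_eq_norm]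
      refine lp.norm_le_of_forall_le (by positivity) fun i => ?_
      rw [lp.coeFn_sub, Pi.sub_apply, hψ, hUs]
      split_ifs with hi
      · rw [sub_self, norm_zero]; positivity
      · rw [sub_zero]
        have : dist ‖b.1 i‖ 0 < ε / 2 := by
          by_contra h
          exact hi (hfin.mem_toFinset.2 h)
        rw [dist_zero_right, norm_norm] at this
        exact this.le
    rw [hiso.isClosedEmbedding.isClosed_range.closure_eq] at hb
    obtain ⟨x, hx⟩ := hb
    exact ⟨x, Subtype.ext hx⟩

end DirectSum

namespace Ext

/-! ### Density of the homogeneous functions, and finiteness of the twisted norms. -/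

section Density

variable {G : Type u} [TopologicalSpace G] [ArrowGroupoid G] [TopologicalGroupoid G]
  [SecondCountableTopology G] [LocallyCompactSpace G] [T2Space G] [MeasurableSpace G]
  [BorelSpace G] {ω : TwoCocycle G}

/-- Trigonometric polynomials are uniformly dense in the continuous functions on the circle. -/
theorem exists_trigPolynomial_approx (g : C(Circle, ℂ)) {ε : ℝ} (hε : 0 < ε) :
    ∃ c : ℤ →₀ ℂ, ∀ t, ‖g t - ∑ n ∈ c.support, c n * ((t ^ n : Circle) : ℂ)‖ ≤ ε := by
  have : Fact (0 < 2 * Real.pi) := ⟨Real.two_pi_pos⟩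
  let τ : C(AddCircle (2 * Real.pi), Circle) := ⟨AddCircle.toCircle, AddCircle.continuous_toCircle⟩
  -- The density of Fourier monomials on the additive circle is transported along `τ`.
  have hmem : g.comp τ ∈ (Submodule.span ℂ (Set.range
      (fourier (T := 2 * Real.pi)))).topologicalClosure := by
    rw [span_fourier_closure_eq_top]; trivial
  obtain ⟨p, hp, hgp⟩ := Metric.mem_closure_iff.1 hmem ε hε
  obtain ⟨c, rfl⟩ := Finsupp.mem_span_range_iff_exists_finsupp.1 hp
  refine ⟨c, fun t => ?_⟩
  obtain ⟨x, rfl⟩ : ∃ x, AddCircle.toCircle (T := 2 * Real.pi) x = t := by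
    obtain ⟨x, hx⟩ := (AddCircle.homeomorphCircle Real.two_pi_pos.ne').surjective t
    exact ⟨x, by rwa [AddCircle.homeomorphCircle_apply] at hx⟩
  have h1 := (ContinuousMap.norm_coe_le_norm (g.comp τ - c.sum fun n a => a • fourier n) x).trans
    (le_of_lt (by rwa [dist_eq_norm] at hgp))
  have h2 : (c.sum fun n a => a • fourier n : C(AddCircle (2 * Real.pi), ℂ)) x =
      ∑ n ∈ c.support, c n * ((AddCircle.toCircle x ^ n : Circle) : ℂ) := by
    rw [Finsupp.sum, ContinuousMap.sum_apply]
    refine Finset.sum_congr rfl fun n _ => ?_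
    rw [ContinuousMap.smul_apply, fourier_apply, AddCircle.toCircle_zsmul, smul_eq_mul]
  rw [ContinuousMap.sub_apply, h2] at h1
  exact h1

/-- Every function in `C_c(G^ω)` is a limit, uniform with supports in a fixed compact set, of sums
of functions `t⁻ⁿ f(γ)`. -/
theorem exists_embed_approx (F : C_c(Ext ω, ℂ)) :
    ∃ K : Set (Ext ω), IsCompact K ∧ ∀ ε > 0, ∃ d ∈ AddSubmonoid.closure
      {d : C_c(Ext ω, ℂ) | ∃ n f, d = embed ω n f},
      tsupport (F - d : C_c(Ext ω, ℂ)) ⊆ K ∧ ∀ a, ‖(F - d) a‖ ≤ ε := by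
  set L₀ : Set G := arr '' tsupport F with hL₀
  have hL₀c : IsCompact L₀ := F.hasCompactSupport.isCompact.image continuous_arr
  have hFL : ∀ s, ∀ η ∉ L₀, F (mk ω s η) = 0 := fun s η hη =>
    image_eq_zero_of_notMem_tsupport fun h => hη ⟨_, h, rfl⟩
  -- The factors are swapped so that the `G` variable is the one frozen, leaving functions of `t`
  -- alone to approximate.
  let F' : C_c(G × Circle, ℂ) :=
    ⟨⟨fun p => F (mk ω p.2 p.1), F.continuous.comp (continuous_mk.comp continuous_swap)⟩,
      HasCompactSupport.intro (hL₀c.prod isCompact_univ) fun p hp =>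
        hFL p.2 p.1 fun h => hp ⟨h, Set.mem_univ _⟩⟩
  obtain ⟨L, hLc, hL⟩ := exists_partition_approx F'
  refine ⟨arr ⁻¹' (L ∪ L₀), isCompact_arr_preimage (hLc.union hL₀c), fun ε hε => ?_⟩
  obtain ⟨s, χ, hχc, hχ0, hχL, hχ1, hχF, hχε⟩ := hL (ε / 2) (by positivity)
  have hF'mk : ∀ t γ, F' (γ, t) = F (mk ω t γ) := fun _ _ => rfl
  choose c hc using fun i : s => exists_trigPolynomial_approx
    ⟨fun t => F (mk ω t i), F.continuous.comp (continuous_mk_left (i : G))⟩ (half_pos hε)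
  let χc : s → C_c(G, ℂ) := fun i => ⟨⟨fun x => (χ i x : ℂ), by fun_prop⟩,
    (hχc i).comp_left (g := fun x : ℝ => (x : ℂ)) Complex.ofReal_zero⟩
  have hd : ∀ t γ, (∑ i, ∑ n ∈ (c i).support, embed ω (-n) (c i n • χc i)) (mk ω t γ) =
      ∑ i, (χ i γ : ℂ) * ∑ n ∈ (c i).support, c i n * ((t ^ n : Circle) : ℂ) := by
    intro t γ
    simp only [CompactlySupportedContinuousMap.sum_apply, Finset.mul_sum]
    refine Finset.sum_congr rfl fun i _ => Finset.sum_congr rfl fun n _ => ?_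
    rw [embed_mk, neg_neg, CompactlySupportedContinuousMap.smul_apply, smul_eq_mul]
    change _ * (c i n * (χ i γ : ℂ)) = _
    ring
  refine ⟨∑ i, ∑ n ∈ (c i).support, embed ω (-n) (c i n • χc i),
    sum_mem fun i _ => sum_mem fun n _ => AddSubmonoid.subset_closure ⟨_, _, rfl⟩,
    tsupport_subset_of_isCompact (isCompact_arr_preimage (hLc.union hL₀c)) fun a ha => ?_,
    fun a => ?_⟩
  · rw [CompactlySupportedContinuousMap.sub_apply]
    have h1 : F a = 0 := hFL a.circ a.arr fun h => ha (Or.inr h)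
    have h2 := hd a.circ a.arr
    have h3 : ∀ i, χ i a.arr = 0 := fun i => hχL i _ fun h => ha (Or.inl h)
    simp only [h3, Complex.ofReal_zero, zero_mul, Finset.sum_const_zero] at h2
    rw [h1, zero_sub, neg_eq_zero]
    exact h2
  · set t := a.circ
    set γ := a.arr
    set q : s → ℂ := fun i => ∑ n ∈ (c i).support, c i n * ((t ^ n : Circle) : ℂ) with hq
    have e1 : (F - ∑ i, ∑ n ∈ (c i).support, embed ω (-n) (c i n • χc i)) a =
        F (mk ω t γ) - ∑ i, (χ i γ : ℂ) * q i := congrArg (F (mk ω t γ) - ·) (hd t γ)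
    have e2 : F (mk ω t γ) = ∑ i, (χ i γ : ℂ) * F (mk ω t γ) := by
      by_cases h0 : F (mk ω t γ) = 0
      · simp [h0]
      · rw [← Finset.sum_mul, ← Complex.ofReal_sum, hχF γ t h0, Complex.ofReal_one, one_mul]
    rw [e1, e2, ← Finset.sum_sub_distrib]
    refine (norm_sum_le _ _).trans ?_
    -- One `ε / 2` pays for freezing `γ` at `i`, the other for the trigonometric polynomial.
    calc _ ≤ ∑ i, χ i γ * ε := by
          refine Finset.sum_le_sum fun i _ => ?_
          rw [← mul_sub, norm_mul, Complex.norm_real, Real.norm_of_nonneg (hχ0 i γ)]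
          by_cases hi : χ i γ = 0
          · simp [hi]
          · refine mul_le_mul_of_nonneg_left ?_ (hχ0 i γ)
            have h1 : ‖F (mk ω t γ) - F (mk ω t i)‖ ≤ ε / 2 := hχε i γ hi t
            have h2 : ‖F (mk ω t i) - q i‖ ≤ ε / 2 := hc i t
            calc _ = ‖(F (mk ω t γ) - F (mk ω t i)) + (F (mk ω t i) - q i)‖ := by
                  rw [sub_add_sub_cancel]
              _ ≤ ε / 2 + ε / 2 := (norm_add_le _ _).trans (add_le_add h1 h2)
              _ = ε := add_halves ε
      _ = (∑ i, χ i γ) * ε := by rw [Finset.sum_mul]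
      _ ≤ 1 * ε := by gcongr; exact hχ1 γ
      _ = ε := one_mul ε

/-- `f = Υ_n(embed_n f)`, and twisted representations pull back along `Υ_n` to representations of
the untwisted algebra of `G^ω`, where the bound is known. -/
theorem finiteNorm_zpow (lam : HaarSystem G) (ω : TwoCocycle G) (n : ℤ) (f : C_c(G, ℂ)) :
    FiniteNorm lam (ω ^ n) f := by
  have h := (finiteNorm_one (haarSystem lam ω) (embed ω n f)).map (upsilonHom lam ω n)
  have h1 : (upsilonHom lam ω n).toLin (embed ω n f) = f :=
    (upsilon_embed n n f).trans (if_pos rfl)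
  rwa [h1] at h

end Density

/-! ### Relations between the induced maps on the completions. -/

section Decomposition

variable {G : Type u} [TopologicalSpace G] [ArrowGroupoid G] [TopologicalGroupoid G]
  [SecondCountableTopology G] [LocallyCompactSpace G] [T2Space G] [MeasurableSpace G]
  [BorelSpace G] (lam : HaarSystem G) (ω : TwoCocycle G)

theorem map_embedHom_toCStar (n : ℤ) (f : C_c(G, ℂ)) :
    CStar.map (embedHom lam ω n) (toCStar lam (ω ^ n) f) =
      toCStar (haarSystem lam ω) 1 (embed ω n f) :=
  CStar.map_toCStar _ (finiteNorm_zpow lam ω n f)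

theorem map_upsilonHom_toCStar (n : ℤ) (F : C_c(Ext ω, ℂ)) :
    CStar.map (upsilonHom lam ω n) (toCStar (haarSystem lam ω) 1 F) =
      toCStar lam (ω ^ n) (upsilon n F) :=
  CStar.map_toCStar _ (finiteNorm_one _ F)

theorem map_upsilonHom_map_embedHom_self (n : ℤ) (b : CStar lam (ω ^ n)) :
    CStar.map (upsilonHom lam ω n) (CStar.map (embedHom lam ω n) b) = b := by
  refine (denseRange_toCStar lam (ω ^ n)).induction_on b
    (isClosed_eq ((continuous_nonUnitalStarAlgHom _).comp (continuous_nonUnitalStarAlgHom _))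
      continuous_id) fun f => ?_
  rw [map_embedHom_toCStar, map_upsilonHom_toCStar, upsilon_embed, if_pos rfl]

theorem map_upsilonHom_map_embedHom_of_ne {m n : ℤ} (h : m ≠ n) (b : CStar lam (ω ^ n)) :
    CStar.map (upsilonHom lam ω m) (CStar.map (embedHom lam ω n) b) = 0 := by
  refine (denseRange_toCStar lam (ω ^ n)).induction_on b
    (isClosed_eq ((continuous_nonUnitalStarAlgHom _).comp (continuous_nonUnitalStarAlgHom _))
      continuous_const) fun f => ?_
  rw [map_embedHom_toCStar, map_upsilonHom_toCStar, upsilon_embed, if_neg h, toCStar_zero]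

theorem map_embedHom_mul_of_ne {m n : ℤ} (h : m ≠ n) (a : CStar lam (ω ^ m))
    (b : CStar lam (ω ^ n)) :
    CStar.map (embedHom lam ω m) a * CStar.map (embedHom lam ω n) b = 0 := by
  refine (denseRange_toCStar lam (ω ^ m)).induction_on a (isClosed_eq
    ((continuous_nonUnitalStarAlgHom _).mul continuous_const) continuous_const) fun f => ?_
  refine (denseRange_toCStar lam (ω ^ n)).induction_on b (isClosed_eq
    (continuous_const.mul (continuous_nonUnitalStarAlgHom _)) continuous_const) fun g => ?_
  rw [map_embedHom_toCStar, map_embedHom_toCStar, ← toCStar_conv (finiteNorm_one _ _)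
    (finiteNorm_one _ _) (finiteNorm_one _ _), conv_embed, if_neg h, toCStar_zero]

theorem dense_closure_map_embedHom :
    Dense (AddSubmonoid.closure {x : CStar (haarSystem lam ω) 1 |
      ∃ n b, x = CStar.map (embedHom lam ω n) b} : Set (CStar (haarSystem lam ω) 1)) := by
  have hmem : ∀ d ∈ AddSubmonoid.closure {d : C_c(Ext ω, ℂ) | ∃ n f, d = embed ω n f},
      toCStar (haarSystem lam ω) 1 d ∈ AddSubmonoid.closure {x : CStar (haarSystem lam ω) 1 |
        ∃ n b, x = CStar.map (embedHom lam ω n) b} := by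
    intro d hd
    induction hd using AddSubmonoid.closure_induction with
    | mem d hd =>
      obtain ⟨n, f, rfl⟩ := hd
      exact AddSubmonoid.subset_closure ⟨n, _, (map_embedHom_toCStar lam ω n f).symm⟩
    | zero => rw [toCStar_zero]; exact zero_mem _
    | add d d' _ _ h h' =>
      rw [toCStar_add (finiteNorm_one _ _) (finiteNorm_one _ _) (finiteNorm_one _ _)]
      exact add_mem h h'
  refine dense_closure.1 ((denseRange_toCStar (haarSystem lam ω) 1).mono ?_)
  rintro _ ⟨F, rfl⟩
  obtain ⟨K, hK, hF⟩ := exists_embed_approx F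
  obtain ⟨C, hC0, hC⟩ := exists_norm_toCStar_le (haarSystem lam ω) hK
  refine Metric.mem_closure_iff.2 fun ε hε => ?_
  -- `C` may be zero; dividing by `C + 1` keeps `C * (ε / (C + 1)) < ε`.
  obtain ⟨d, hd, hdK, hdε⟩ := hF (ε / (C + 1)) (by positivity)
  refine ⟨_, hmem d hd, ?_⟩
  rw [dist_eq_norm, ← toCStar_sub (finiteNorm_one _ _) (finiteNorm_one _ _) (finiteNorm_one _ _)]
  refine (hC _ hdK _ (by positivity) hdε).trans_lt ?_
  rw [mul_div_assoc', div_lt_iff₀ (by positivity)]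
  nlinarith

end Decomposition

end Ext

end GroupoidCStar

/-! ### The decomposition theorem. -/

open GroupoidCStar in
theorem theorem3p2 {G : Type u} [TopologicalSpace G] [ArrowGroupoid G] [TopologicalGroupoid G]
    [SecondCountableTopology G] [LocallyCompactSpace G] [T2Space G] [MeasurableSpace G]
    [BorelSpace G] (lam : HaarSystem G) (ω : TwoCocycle G) :
    (∀ F : C_c(Ext ω, ℂ), FiniteNorm (Ext.haarSystem lam ω) 1 F) ∧
    (∀ (n : ℤ) (f : C_c(G, ℂ)), FiniteNorm lam (ω ^ n) f) ∧
    ∃ Φ : CStar (Ext.haarSystem lam ω) 1 ≃⋆ₐ[ℂ] directSum fun n : ℤ => CStar lam (ω ^ n),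
      ∀ (F : C_c(Ext ω, ℂ)) (n : ℤ),
        (Φ (toCStar (Ext.haarSystem lam ω) 1 F)).1 n = toCStar lam (ω ^ n) (Ext.upsilon n F) := by
  refine ⟨finiteNorm_one _, Ext.finiteNorm_zpow lam ω, ?_⟩
  obtain ⟨Φ, hΦ⟩ := exists_starAlgEquiv_directSum
    (fun n => CStar.map (Ext.embedHom lam ω n)) (fun n => CStar.map (Ext.upsilonHom lam ω n))
    (Ext.map_upsilonHom_map_embedHom_self lam ω)
    (fun _ _ h => Ext.map_upsilonHom_map_embedHom_of_ne lam ω h)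
    (fun _ _ h => Ext.map_embedHom_mul_of_ne lam ω h) (Ext.dense_closure_map_embedHom lam ω)
  exact ⟨Φ, fun F n => (hΦ _ n).trans (Ext.map_upsilonHom_toCStar lam ω n F)⟩
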